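/- **Conventions.** Let $\mathcal C=(C,P,\partial)$ be a crossed module: groups $C,P$, a left action $(p,c)\mapsto {}^pc$ of $P$ on $C$ by automorphisms, and a homomorphism $\partial:C\to P$ with $\partial({}^pc)=p\,\partial c\,p^{-1}$ and ${}^{\partial c}c'=c\,c'\,c^{-1}$. For a simplicial complex $K$ (possibly infinite), $|K|$ is its geometric realisation with the weak topology. A subdivision of $K$ is a simplicial complex $K'$ with a homeomorphism $|K'|\cong|K|$ which is affine on each simplex of $K'$ and maps it into a simplex of $K$. A *formal $\mathcal C$-map* on $K$ consists of elements $c_t\in C$ for the 2-simplices $t$ of $K$, elements $p_e\in P$ for the 1-simplices $e$ of $K$, and a partial order on the vertices of $K$ in which every simplex is totally ordered, such that * (boundary condition) for every 2-simplex $t$ with vertices $v_0<v_1<v_2$, $\partial c_t=p_1p_0^{-1}p_2^{-1}$, where $p_i$ is the label of the edge opposite $v_i$; * (cocycle condition) for every 3-simplex with vertices $v_0<v_1<v_2<v_3$, $c_2\cdot{}^{p_{01}}c_0=c_1c_3$, where $c_i$ is the label of the face opposite $v_i$ and $p_{01}$ is the label of the edge $\{v_0,v_1\}$. Let $X$ be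 a space with a set $\mathbf m\subseteq X$ of base points, and let $K_0,K_1$ be triangulations of $X$ (with specified homeomorphisms $|K_j|\cong X$) that have all base points among their vertices. Formal $\mathcal C$-maps $\lambda_0$ on $K_0$ and $\lambda_1$ on $K_1$ are *equivalent* if there are a triangulation $T$ of $X\times I$, $I=[0,1]$, that extends $K_0$ on $X\times\{0\}$ and $K_1$ on $X\times\{1\}$, and a formal $\mathcal C$-map $\Lambda$ on $T$ that restricts to $\lambda_0$ and $\lambda_1$ (labels and orders) on the two ends, such that for every $m\in\mathbf m$ the segment $\{m\}\times I$ is triangulated by a subcomplex of $T$, to each edge of which $\Lambda$ assigns $1_P$. **Proposition.** Let $K$ be a simplicial complex, $X=|K|$, let $K'$ be a subdivision of $K$, and let any set of vertices of $K$ be given as base points. (a) For every formal $\mathcal C$-map $\lambda$ on $K$ there is a formal $\mathcal C$-map $\lambda'$ on $K'$ that is equivalent to $\lambda$. (b) For every formal $\mathcal C$-map $\lambda'$ on $K'$ there is a formal $\mathcal C$-map $\lambda$ on $K$ that is equivalent to $\lambda'$. -/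

import Mathlib

universe u v w

/-- A crossed module `∂ : C → P`: a `P`-group `C` (a left action by automorphisms) with a
homomorphism `∂` which is `P`-equivariant and satisfies the Peiffer identity. -/
structure CrossedModule (C : Type v) (P : Type w) [Group C] [Group P]
    [MulDistribMulAction P C] where
  bd : C →* P
  bd_smul : ∀ (p : P) (c : C), bd (p • c) = p * bd c * p⁻¹
  peiffer : ∀ c c' : C, bd c • c' = c * c' * c⁻¹

namespace AbstractSimplicialComplex

/-- The set `K_n` of `n`-simplices of `K`. -/
abbrev Simplex {V : Type u} (K : AbstractSimplicialComplex V) (n : ℕ) : Type u :=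
  {s : Finset V // s ∈ K.faces ∧ s.card = n + 1}

/-- The points of the geometric realisation `|K|`, given by their barycentric coordinates. -/
@[ext]
structure Realization {V : Type u} (K : AbstractSimplicialComplex V) : Type u where
  weight : V →₀ ℝ
  nonneg : ∀ v, 0 ≤ weight v
  sum_eq_one : (weight.sum fun _ a => a) = 1
  support_mem : weight.support ∈ K.faces

namespace Realization

variable {V : Type u} {K : AbstractSimplicialComplex V}

/-- The closed simplex `|s|`, as a subset of `|K|`. -/
def closedSimplex (K : AbstractSimplicialComplex V) (s : Finset V) : Set (Realization K) :=
  {x | x.weight.support ⊆ s}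

/-- The weak (coherent) topology on `|K|`: every closed simplex `|s|` carries its Euclidean
topology (that of the barycentric coordinates), and a subset of `|K|` is open iff its trace on
every closed simplex is open. -/
instance : TopologicalSpace (Realization K) :=
  ⨆ s : {s : Finset V // s ∈ K.faces},
    TopologicalSpace.coinduced (Subtype.val : closedSimplex K s.1 → Realization K)
      (TopologicalSpace.induced (fun x (v : V) => x.1.weight v) inferInstance)

/-- The point of `|K|` given by a vertex of `K`. -/
noncomputable def vertex (K : AbstractSimplicialComplex V) (v : V) : Realization K where
  weight := Finsupp.single v 1
  nonneg u := by
    classical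
    rw [Finsupp.single_apply]
    split_ifs <;> norm_num
  sum_eq_one := by simp
  support_mem := by
    rw [Finsupp.support_single v one_ne_zero]
    exact K.singleton_mem v

end Realization

open Realization

/-- `K'` is a subdivision of `K`: there is a homeomorphism `|K'| ≃ |K|` that carries each simplex
of `K'` into a simplex of `K` and is affine on each simplex of `K'`. -/
structure Subdivision {V' V : Type u} (K' : AbstractSimplicialComplex V')
    (K : AbstractSimplicialComplex V) where
  homeo : Realization K' ≃ₜ Realization K
  exists_face : ∀ s' ∈ K'.faces, ∃ s ∈ K.faces,
    ∀ x ∈ closedSimplex K' s', homeo x ∈ closedSimplex K s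
  affine : ∀ (x : Realization K') (w : V),
    (homeo x).weight w = x.weight.sum fun v a => a * (homeo (vertex K' v)).weight w

/-- An isomorphism of `K` onto a subcomplex of `T`. -/
structure Emb {V W : Type u} (K : AbstractSimplicialComplex V)
    (T : AbstractSimplicialComplex W) where
  toFun : V ↪ W
  map_mem : ∀ s ∈ K.faces, s.map toFun ∈ T.faces

namespace Emb

variable {V W : Type u} {K : AbstractSimplicialComplex V} {T : AbstractSimplicialComplex W}

/-- The induced map on `n`-simplices. -/
def onSimplex (i : Emb K T) {n : ℕ} (s : K.Simplex n) : T.Simplex n :=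
  ⟨s.1.map i.toFun, i.map_mem s.1 s.2.1, by rw [Finset.card_map]; exact s.2.2⟩

/-- The induced map on geometric realisations. -/
noncomputable def realize (i : Emb K T) (x : Realization K) : Realization T where
  weight := x.weight.embDomain i.toFun
  nonneg w := by
    by_cases hw : w ∈ Set.range i.toFun
    · obtain ⟨v, rfl⟩ := hw
      rw [Finsupp.embDomain_apply_self]
      exact x.nonneg v
    · rw [Finsupp.embDomain_of_notMem_range _ _ _ hw]
  sum_eq_one := by
    rw [Finsupp.sum_embDomain]
    exact x.sum_eq_one
  support_mem := by
    rw [Finsupp.support_embDomain]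
    exact i.map_mem _ x.support_mem

end Emb

end AbstractSimplicialComplex

open AbstractSimplicialComplex AbstractSimplicialComplex.Realization

/-- A (simplicial) formal `𝒞`-map on `K`. -/
structure FormalMap {C : Type v} {P : Type w} [Group C] [Group P] [MulDistribMulAction P C]
    (𝒞 : CrossedModule C P) {V : Type u} (K : AbstractSimplicialComplex V) where
  /-- the labels of the triangles -/
  c : K.Simplex 2 → C
  /-- the labels of the edges -/
  p : K.Simplex 1 → P
  /-- a partial order on the vertices -/
  order : PartialOrder V
  /-- in which each simplex is totally ordered -/
  total : ∀ s ∈ K.faces, ∀ u ∈ s, ∀ v ∈ s, order.le u v ∨ order.le v u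
  /-- the boundary condition in a triangle with vertices `v₀ < v₁ < v₂`, where `eᵢ` is the edge
  opposite to `vᵢ` -/
  boundary : ∀ v₀ v₁ v₂ : V, order.lt v₀ v₁ → order.lt v₁ v₂ →
    ∀ (t : K.Simplex 2) (e₀ e₁ e₂ : K.Simplex 1),
      (t.1 : Set V) = {v₀, v₁, v₂} → (e₀.1 : Set V) = {v₁, v₂} →
      (e₁.1 : Set V) = {v₀, v₂} → (e₂.1 : Set V) = {v₀, v₁} →
      𝒞.bd (c t) = p e₁ * (p e₀)⁻¹ * (p e₂)⁻¹
  /-- the cocycle condition in a tetrahedron with vertices `v₀ < v₁ < v₂ < v₃`, where `tᵢ` is the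
  face opposite to `vᵢ` -/
  cocycle : ∀ v₀ v₁ v₂ v₃ : V, order.lt v₀ v₁ → order.lt v₁ v₂ → order.lt v₂ v₃ →
    ∀ (s : K.Simplex 3) (t₀ t₁ t₂ t₃ : K.Simplex 2) (e : K.Simplex 1),
      (s.1 : Set V) = {v₀, v₁, v₂, v₃} →
      (t₀.1 : Set V) = {v₁, v₂, v₃} → (t₁.1 : Set V) = {v₀, v₂, v₃} →
      (t₂.1 : Set V) = {v₀, v₁, v₃} → (t₃.1 : Set V) = {v₀, v₁, v₂} →
      (e.1 : Set V) = {v₀, v₁} →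
      c t₂ * (p e • c t₀) = c t₁ * c t₃

namespace FormalMap

variable {C : Type v} {P : Type w} [Group C] [Group P] [MulDistribMulAction P C]
  {𝒞 : CrossedModule C P}

/-- The formal map `Φ` on `T` extends the formal map `φ` on the subcomplex `K` of `T`. -/
structure Extends {V W : Type u} {K : AbstractSimplicialComplex V}
    {T : AbstractSimplicialComplex W} (Φ : FormalMap 𝒞 T) (i : Emb K T) (φ : FormalMap 𝒞 K) :
    Prop where
  c_eq : ∀ t : K.Simplex 2, Φ.c (i.onSimplex t) = φ.c t
  p_eq : ∀ e : K.Simplex 1, Φ.p (i.onSimplex e) = φ.p e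
  le_iff : ∀ u v : V, Φ.order.le (i.toFun u) (i.toFun v) ↔ φ.order.le u v

/-- Let `h₀ : |K₀| ≃ X` and `h₁ : |K₁| ≃ X` be triangulations of a space `X` with base points
`m ⊆ X`, which are vertices of both triangulations. The formal maps `φ₀` on `K₀` and `φ₁` on `K₁`
are equivalent if there are a triangulation `H : |T| ≃ X × I` that restricts to `K₀` on `X × {0}`
and to `K₁` on `X × {1}`, and a formal map `Φ` on `T` that extends `φ₀` and `φ₁`, such that for
each base point `x` the segment `{x} × I` is triangulated by a subcomplex of `T` on whose edges
the labels of `Φ` are trivial. -/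
def Equivalent {X : Type u} [TopologicalSpace X] (m : Set X)
    {V₀ V₁ : Type u} {K₀ : AbstractSimplicialComplex V₀} {K₁ : AbstractSimplicialComplex V₁}
    (h₀ : Realization K₀ ≃ₜ X) (h₁ : Realization K₁ ≃ₜ X)
    (φ₀ : FormalMap 𝒞 K₀) (φ₁ : FormalMap 𝒞 K₁) : Prop :=
  (∀ x ∈ m, (∃ v, h₀ (vertex K₀ v) = x) ∧ (∃ v, h₁ (vertex K₁ v) = x)) ∧
  ∃ (W : Type u) (T : AbstractSimplicialComplex W) (H : Realization T ≃ₜ X × unitInterval)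
    (i₀ : Emb K₀ T) (i₁ : Emb K₁ T) (Φ : FormalMap 𝒞 T),
    (∀ x, H (i₀.realize x) = (h₀ x, 0)) ∧
    (∀ x, H (i₁.realize x) = (h₁ x, 1)) ∧
    Φ.Extends i₀ φ₀ ∧
    Φ.Extends i₁ φ₁ ∧
    ∀ x ∈ m,
      (∀ r : unitInterval, ∃ s ∈ T.faces,
        (x, r) ∈ H '' closedSimplex T s ∧ H '' closedSimplex T s ⊆ {x} ×ˢ Set.univ) ∧
      ∀ e : T.Simplex 1, H '' closedSimplex T e.1 ⊆ {x} ×ˢ Set.univ → Φ.p e = 1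

end FormalMap

/-!
A formal `𝒞`-map on `K` labels only increasing edges and triangles. It extends to a cocycle on all
ordered pairs and triples of vertices of a simplex, repetitions allowed
(`FormalMap.exists_isCocycleOn`): the label of a triple is the one that the cocycle condition forces
on the base of the cone with apex the least vertex of the triple. The order no longer matters for
cocycles, and they pull back along maps of points.

It therefore suffices to label all pairs and triples of points that lie in a common closed simplex
of `K` by a cocycle with the given values at the vertices of `K`, or at those of `K'`. The cylinder
`|K| × I` has a triangulation `Subdivision.cylinder` which restricts to `K` and `K'` at its ends and
has no other vertices. A vertex of it is labelled by its projection to `|K|`, so that the cocycle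
gives a formal map on the cylinder, whose restrictions to the two ends are equivalent
(`FormalMap.equivalent_of_isCocycleOn`). The segment over a base point is a single edge, labelled by
the pair `(x, x)`, hence trivially.

For (a), the cocycle on vertices of `K` is pulled back along any map that sends a point to a vertex
of the simplex that contains it in its interior
(`FormalMap.exists_isCocycleOn_cell`). For (b), points of `|K|` are sent to a vertex of `K'` at
which their barycentric coordinate with respect to `K'` is maximal. This yields a cocycle only on
tuples of points that are close to each other, so that these vertices span a simplex of `K'`
(`Subdivision.isFineIn_smallSets`).

The main step is that a cocycle on small sets extends to the closed simplices of `K`, or more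
generally to convex sets (`CrossedModule.IsCocycleOn.exists_extension`). Modulo `∂ C`, the labels of
pairs are multiplicative on small sets, and extend by transport along segments
(`AffineChain.IsFineIn.exists_functor`). Lifts to `P`, and then labels of triples that satisfy the
boundary condition, are chosen arbitrarily outside the small sets. The failure of the cocycle
condition is a cocycle of degree three that vanishes on small sets, with values in `ker ∂`, on which
`∂ C` acts trivially. Iterated barycentric subdivision makes every simplex small, and its chain
homotopy to the identity therefore provides a primitive that vanishes on small sets
(`AffineChain.IsFineIn.exists_primitive`), which corrects the labels of triples.
-/

/-! ### Cocycles indexed by arbitrary tuples of points -/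

namespace CrossedModule

variable {C : Type v} {P : Type w} [Group C] [Group P] [MulDistribMulAction P C]

/-- A `𝒞`-valued cocycle on a family `𝓤` of subsets of `X`: labels `p x y` and `c x y z` of all
ordered pairs and triples, repetitions allowed, which satisfy the boundary and the cocycle
condition on every tuple that lies in a member of `𝓤`. Labels of tuples that do not lie in a
member of `𝓤` are junk. -/
structure IsCocycleOn (𝒞 : CrossedModule C P) {X : Type*} (𝓤 : Set (Set X))
    (p : X → X → P) (c : X → X → X → C) : Prop where
  p_self : ∀ U ∈ 𝓤, ∀ x ∈ U, p x x = 1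
  boundary : ∀ U ∈ 𝓤, ∀ x ∈ U, ∀ y ∈ U, ∀ z ∈ U,
    𝒞.bd (c x y z) = p x z * (p y z)⁻¹ * (p x y)⁻¹
  cocycle : ∀ U ∈ 𝓤, ∀ x ∈ U, ∀ y ∈ U, ∀ z ∈ U, ∀ t ∈ U,
    c x y t * p x y • c y z t = c x z t * c x y z

theorem IsCocycleOn.comp {𝒞 : CrossedModule C P} {X Y : Type*} {𝓤 : Set (Set X)}
    {𝓥 : Set (Set Y)} {p : X → X → P} {c : X → X → X → C} (h : 𝒞.IsCocycleOn 𝓤 p c)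
    (f : Y → X) (hf : ∀ V ∈ 𝓥, ∃ U ∈ 𝓤, ∀ y ∈ V, f y ∈ U) :
    𝒞.IsCocycleOn 𝓥 (fun x y => p (f x) (f y)) (fun x y z => c (f x) (f y) (f z)) where
  p_self V hV x hx := by
    obtain ⟨U, hU, hVU⟩ := hf V hV
    exact h.p_self U hU _ (hVU x hx)
  boundary V hV x hx y hy z hz := by
    obtain ⟨U, hU, hVU⟩ := hf V hV
    exact h.boundary U hU _ (hVU x hx) _ (hVU y hy) _ (hVU z hz)
  cocycle V hV x hx y hy z hz t ht := by
    obtain ⟨U, hU, hVU⟩ := hf V hV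
    exact h.cocycle U hU _ (hVU x hx) _ (hVU y hy) _ (hVU z hz) _ (hVU t ht)

theorem isCocycleOn_one (𝒞 : CrossedModule C P) {X : Type*} (𝓤 : Set (Set X)) :
    𝒞.IsCocycleOn 𝓤 (fun _ _ => 1) (fun _ _ _ => 1) where
  p_self _ _ _ _ := rfl
  boundary := by intros; simp
  cocycle := by intros; simp

/-- The label of the triangle `(x, y, z)` that is forced by the cocycle condition in the
tetrahedron `(m, x, y, z)`, where `h x y` is the label of the triangle `(m, x, y)` and `q x` that
of the edge `(m, x)`. -/
def coneLabel {X : Type*} (q : X → P) (h : X → X → C) (x y z : X) : C :=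
  (q x)⁻¹ • ((h x z)⁻¹ * h y z * h x y)

/-- Labels of the triangles of a cone determine labels on its base that satisfy the boundary
condition. -/
theorem bd_coneLabel (𝒞 : CrossedModule C P) {X : Type*} {q : X → P} {h : X → X → C}
    {p : X → X → P} {x y z : X}
    (hxy : 𝒞.bd (h x y) = q y * (p x y)⁻¹ * (q x)⁻¹)
    (hxz : 𝒞.bd (h x z) = q z * (p x z)⁻¹ * (q x)⁻¹)
    (hyz : 𝒞.bd (h y z) = q z * (p y z)⁻¹ * (q y)⁻¹) :
    𝒞.bd (coneLabel q h x y z) = p x z * (p y z)⁻¹ * (p x y)⁻¹ := by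
  rw [coneLabel, 𝒞.bd_smul, map_mul, map_mul, map_inv, hxy, hxz, hyz]
  group

/-- Labels of the triangles of a cone determine labels on its base that satisfy the cocycle
condition. -/
theorem coneLabel_cocycle (𝒞 : CrossedModule C P) {X : Type*} {q : X → P} {h : X → X → C}
    {p : X → X → P} {x y z t : X}
    (hxy : 𝒞.bd (h x y) = q y * (p x y)⁻¹ * (q x)⁻¹) :
    coneLabel q h x y t * p x y • coneLabel q h y z t =
      coneLabel q h x z t * coneLabel q h x y z := by
  have key : p x y * (q y)⁻¹ = (q x)⁻¹ * 𝒞.bd (h x y)⁻¹ := by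
    rw [map_inv, hxy]; group
  simp only [coneLabel]
  rw [smul_smul, key, mul_smul, 𝒞.peiffer, ← smul_mul', ← smul_mul']
  congr 1
  group

end CrossedModule

/-! ### The cocycle of a formal map -/

theorem AbstractSimplicialComplex.mem_faces_of_subset {V : Type u}
    {K : AbstractSimplicialComplex V} {s t : Finset V} (hs : s ∈ K.faces) (hts : t ⊆ s)
    (ht : t.Nonempty) : t ∈ K.faces :=
  (K.isRelLowerSet_faces hs).2 hts ht

namespace FormalMap

open CrossedModule

variable {C : Type v} {P : Type w} [Group C] [Group P] [MulDistribMulAction P C]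
  {𝒞 : CrossedModule C P} {V : Type u} {K : AbstractSimplicialComplex V}

/-- The labels `p`, `c` of ordered tuples of vertices induce the labels of the formal map `φ`. -/
structure HasLabels (φ : FormalMap 𝒞 K) (p : V → V → P) (c : V → V → V → C) : Prop where
  p_eq : ∀ x y, φ.order.lt x y → ∀ e : K.Simplex 1, (e.1 : Set V) = {x, y} → φ.p e = p x y
  c_eq : ∀ x y z, φ.order.lt x y → φ.order.lt y z → ∀ t : K.Simplex 2,
    (t.1 : Set V) = {x, y, z} → φ.c t = c x y z

variable (φ : FormalMap 𝒞 K)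

open Classical in
/-- The label of the edge on the vertex set `{x, y}`. -/
noncomputable def edgeLabel (x y : V) : P :=
  if h : ({x, y} : Finset V) ∈ K.faces ∧ ({x, y} : Finset V).card = 2 then φ.p ⟨{x, y}, h⟩ else 1

open Classical in
/-- The label of the triangle on the vertex set `{x, y, z}`. -/
noncomputable def triLabel (x y z : V) : C :=
  if h : ({x, y, z} : Finset V) ∈ K.faces ∧ ({x, y, z} : Finset V).card = 3 then
    φ.c ⟨{x, y, z}, h⟩ else 1

open Classical in
/-- The label of the ordered pair `(x, y)`: that of an edge if `x < y`, inverse to it if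
`y < x`. -/
noncomputable def pairLabel (x y : V) : P :=
  if φ.order.lt x y then φ.edgeLabel x y else
    if φ.order.lt y x then (φ.edgeLabel y x)⁻¹ else 1

open Classical in
/-- The label of the ordered triple `(m, x, y)` when `m` is its minimum; it is trivial if two of
the vertices coincide. -/
noncomputable def minLabel (m x y : V) : C :=
  if φ.order.lt m x ∧ φ.order.lt x y then φ.triLabel m x y else
    if φ.order.lt m y ∧ φ.order.lt y x then (φ.triLabel m y x)⁻¹ else 1

open Classical in
/-- The label of an arbitrary ordered triple. It is defined by regarding the triple as the base of
a cone whose apex is the least vertex of the triple. -/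
noncomputable def tripleLabel (x y z : V) : C :=
  if h : ∃ m, (m = x ∨ m = y ∨ m = z) ∧ φ.order.le m x ∧ φ.order.le m y ∧ φ.order.le m z then
    coneLabel (φ.pairLabel h.choose) (φ.minLabel h.choose) x y z
  else 1

theorem pairLabel_self (x : V) : φ.pairLabel x x = 1 := by
  let := φ.order
  simp [pairLabel]

theorem minLabel_swap (m x y : V) : φ.minLabel m y x = (φ.minLabel m x y)⁻¹ := by
  let := φ.order
  unfold minLabel
  by_cases h₁ : φ.order.lt m x ∧ φ.order.lt x y
  · have h₂ : ¬ (φ.order.lt m y ∧ φ.order.lt y x) := fun h => lt_asymm (a := x) h₁.2 h.2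
    simp [h₁, h₂]
  · by_cases h₂ : φ.order.lt m y ∧ φ.order.lt y x
    · simp [h₁, h₂]
    · simp [h₁, h₂]

theorem minLabel_left (m x : V) : φ.minLabel m m x = 1 := by
  let := φ.order
  have h : ¬ φ.order.lt m m := lt_irrefl m
  unfold minLabel
  rw [if_neg (fun h' => h h'.1), if_neg]
  exact fun h' => lt_asymm (a := m) h'.1 h'.2

theorem minLabel_self (m x : V) : φ.minLabel m x x = 1 := by
  let := φ.order
  simp [minLabel]

theorem p_eq_edgeLabel {x y : V} (e : K.Simplex 1) (he : (e.1 : Set V) = {x, y}) :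
    φ.p e = φ.edgeLabel x y := by
  classical
  obtain ⟨e, he₁, he₂⟩ := e
  have : e = {x, y} := by
    apply Finset.coe_injective
    simpa using he
  subst this
  rw [edgeLabel, dif_pos ⟨by convert he₁, by convert he₂⟩]

theorem c_eq_triLabel {x y z : V} (t : K.Simplex 2) (ht : (t.1 : Set V) = {x, y, z}) :
    φ.c t = φ.triLabel x y z := by
  classical
  obtain ⟨t, ht₁, ht₂⟩ := t
  have : t = {x, y, z} := by
    apply Finset.coe_injective
    simpa using ht
  subst this
  rw [triLabel, dif_pos ⟨by convert ht₁, by convert ht₂⟩]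

theorem bd_triLabel {s : Finset V} (hs : s ∈ K.faces) {x y z : V} (hx : x ∈ s) (hy : y ∈ s)
    (hz : z ∈ s) (hxy : φ.order.lt x y) (hyz : φ.order.lt y z) :
    𝒞.bd (φ.triLabel x y z) =
      φ.edgeLabel x z * (φ.edgeLabel y z)⁻¹ * (φ.edgeLabel x y)⁻¹ := by
  classical
  let := φ.order
  have nxy : x ≠ y := ne_of_lt hxy
  have nyz : y ≠ z := ne_of_lt hyz
  have nxz : x ≠ z := ne_of_lt (lt_trans (b := y) hxy hyz)
  have hsub : ∀ a ∈ s, ∀ b ∈ s, ({a, b} : Finset V) ∈ K.faces := fun a ha b hb =>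
    mem_faces_of_subset hs (by simp [Finset.insert_subset_iff, *]) (by simp)
  have ht : ({x, y, z} : Finset V) ∈ K.faces :=
    mem_faces_of_subset hs (by simp [Finset.insert_subset_iff, *]) (by simp)
  have := φ.boundary x y z hxy hyz
    ⟨{x, y, z}, ht, Finset.card_eq_three.2 ⟨x, y, z, nxy, nxz, nyz, rfl⟩⟩
    ⟨{y, z}, hsub y hy z hz, Finset.card_pair nyz⟩ ⟨{x, z}, hsub x hx z hz, Finset.card_pair nxz⟩
    ⟨{x, y}, hsub x hx y hy, Finset.card_pair nxy⟩ (by simp) (by simp) (by simp) (by simp)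
  rwa [φ.c_eq_triLabel (x := x) (y := y) (z := z) _ (by simp),
    φ.p_eq_edgeLabel (x := x) (y := z) _ (by simp),
    φ.p_eq_edgeLabel (x := y) (y := z) _ (by simp),
    φ.p_eq_edgeLabel (x := x) (y := y) _ (by simp)] at this

theorem triLabel_cocycle {s : Finset V} (hs : s ∈ K.faces) {x y z t : V} (hx : x ∈ s) (hy : y ∈ s)
    (hz : z ∈ s) (ht : t ∈ s) (hxy : φ.order.lt x y) (hyz : φ.order.lt y z)
    (hzt : φ.order.lt z t) :
    φ.triLabel x y t * φ.edgeLabel x y • φ.triLabel y z t =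
      φ.triLabel x z t * φ.triLabel x y z := by
  classical
  let := φ.order
  have nxy : x ≠ y := ne_of_lt hxy
  have nyz : y ≠ z := ne_of_lt hyz
  have nzt : z ≠ t := ne_of_lt hzt
  have nxz : x ≠ z := ne_of_lt (lt_trans (b := y) hxy hyz)
  have nyt : y ≠ t := ne_of_lt (lt_trans (b := z) hyz hzt)
  have nxt : x ≠ t := ne_of_lt (lt_trans (b := z) (lt_trans (b := y) hxy hyz) hzt)
  have hsub : ∀ a ∈ s, ∀ b ∈ s, ∀ c ∈ s, ({a, b, c} : Finset V) ∈ K.faces := fun a ha b hb c hc =>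
    mem_faces_of_subset hs (by simp [Finset.insert_subset_iff, *]) (by simp)
  have h4 : ({x, y, z, t} : Finset V) ∈ K.faces :=
    mem_faces_of_subset hs (by simp [Finset.insert_subset_iff, *]) (by simp)
  have h2 : ({x, y} : Finset V) ∈ K.faces :=
    mem_faces_of_subset hs (by simp [Finset.insert_subset_iff, *]) (by simp)
  have := φ.cocycle x y z t hxy hyz hzt
    ⟨{x, y, z, t}, h4, Finset.card_eq_of_equiv_fin (Finset.equivFinOfCardEq (by
      rw [Finset.card_insert_of_notMem (by simp [*]), Finset.card_insert_of_notMem (by simp [*]),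
        Finset.card_pair nzt]))⟩
    ⟨{y, z, t}, hsub y hy z hz t ht, Finset.card_eq_three.2 ⟨y, z, t, nyz, nyt, nzt, rfl⟩⟩
    ⟨{x, z, t}, hsub x hx z hz t ht, Finset.card_eq_three.2 ⟨x, z, t, nxz, nxt, nzt, rfl⟩⟩
    ⟨{x, y, t}, hsub x hx y hy t ht, Finset.card_eq_three.2 ⟨x, y, t, nxy, nxt, nyt, rfl⟩⟩
    ⟨{x, y, z}, hsub x hx y hy z hz, Finset.card_eq_three.2 ⟨x, y, z, nxy, nxz, nyz, rfl⟩⟩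
    ⟨{x, y}, h2, Finset.card_pair nxy⟩
    (by simp) (by simp) (by simp) (by simp) (by simp) (by simp)
  rwa [φ.c_eq_triLabel (x := x) (y := y) (z := t) _ (by simp),
    φ.c_eq_triLabel (x := y) (y := z) (z := t) _ (by simp),
    φ.c_eq_triLabel (x := x) (y := z) (z := t) _ (by simp),
    φ.c_eq_triLabel (x := x) (y := y) (z := z) _ (by simp),
    φ.p_eq_edgeLabel (x := x) (y := y) _ (by simp)] at this

theorem bd_minLabel {s : Finset V} (hs : s ∈ K.faces) {m x y : V} (hm : m ∈ s) (hx : x ∈ s)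
    (hy : y ∈ s) (hmx : φ.order.le m x) (hmy : φ.order.le m y) :
    𝒞.bd (φ.minLabel m x y) =
      φ.pairLabel m y * (φ.pairLabel x y)⁻¹ * (φ.pairLabel m x)⁻¹ := by
  let := φ.order
  have lt_def : ∀ a b, φ.order.lt a b ↔ a < b := fun _ _ => Iff.rfl
  rcases eq_or_lt_of_le (a := m) hmx with rfl | hmx'
  · simp [minLabel_left, pairLabel_self]
  rcases eq_or_lt_of_le (a := m) hmy with rfl | hmy'
  · rw [minLabel_swap, minLabel_left, pairLabel_self, pairLabel, pairLabel]
    simp [lt_def, hmx', not_lt_of_gt hmx']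
  rcases φ.total s hs x hx y hy with h | h
  · rcases eq_or_lt_of_le (a := x) h with rfl | hxy
    · simp [minLabel_self, pairLabel_self]
    · simp only [minLabel, pairLabel, lt_def, hmx', hmy', hxy, and_self, if_true]
      exact φ.bd_triLabel hs hm hx hy hmx' hxy
  · rcases eq_or_lt_of_le (a := y) h with rfl | hxy
    · simp [minLabel_self, pairLabel_self]
    · simp only [minLabel, pairLabel, lt_def, hmx', hmy', hxy, and_self, if_true,
        not_lt_of_gt hxy, if_false, and_false, map_inv, φ.bd_triLabel hs hm hy hx hmy' hxy]
      group

/-- The labels of triples with minimum `m'` are those of the base of the cone with apex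
`m ≤ m'`. -/
theorem coneLabel_eq_minLabel {s : Finset V} (hs : s ∈ K.faces) {m m' x y : V} (hm : m ∈ s)
    (hm' : m' ∈ s) (hx : x ∈ s) (hy : y ∈ s) (hmm : φ.order.le m m') (hmx : φ.order.le m' x)
    (hmy : φ.order.le m' y) :
    coneLabel (φ.pairLabel m) (φ.minLabel m) m' x y = φ.minLabel m' x y := by
  let := φ.order
  have lt_def : ∀ a b, φ.order.lt a b ↔ a < b := fun _ _ => Iff.rfl
  -- the case `x < y`, the other one being obtained by inversion
  have key : ∀ x y, x ∈ s → y ∈ s → m' ≤ x → x < y →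
      coneLabel (φ.pairLabel m) (φ.minLabel m) m' x y = φ.minLabel m' x y := by
    intro x y hx hy hmx hxy
    rcases eq_or_lt_of_le (a := m) hmm with rfl | hmm'
    · simp [coneLabel, minLabel_left, pairLabel_self]
    rcases eq_or_lt_of_le hmx with rfl | hmx'
    · simp [coneLabel, minLabel_left, minLabel_self]
    have := φ.triLabel_cocycle hs hm hm' hx hy hmm' hmx' hxy
    simp only [coneLabel, minLabel, pairLabel, lt_def, hmm', hmx', hxy, hmm'.trans hmx',
      hmx'.trans hxy, and_self, if_true]
    rw [inv_smul_eq_iff, mul_assoc, inv_mul_eq_iff_eq_mul]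
    exact this.symm
  rcases φ.total s hs x hx y hy with h | h
  · rcases eq_or_lt_of_le (a := x) h with rfl | hxy
    · simp [coneLabel, minLabel_self]
    · exact key x y hx hy hmx hxy
  · rcases eq_or_lt_of_le (a := y) h with rfl | hxy
    · simp [coneLabel, minLabel_self]
    · rw [minLabel_swap, ← key y x hy hx hmy hxy, coneLabel, coneLabel, minLabel_swap φ m y x,
        ← smul_inv']
      congr 1
      group

/-- The label of a triple may be computed with any vertex `m` below it as apex. -/
theorem tripleLabel_eq {s : Finset V} (hs : s ∈ K.faces) {m x y z : V} (hm : m ∈ s) (hx : x ∈ s)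
    (hy : y ∈ s) (hz : z ∈ s) (hmx : φ.order.le m x) (hmy : φ.order.le m y)
    (hmz : φ.order.le m z) :
    φ.tripleLabel x y z = coneLabel (φ.pairLabel m) (φ.minLabel m) x y z := by
  let := φ.order
  have hex : ∃ m, (m = x ∨ m = y ∨ m = z) ∧ φ.order.le m x ∧ φ.order.le m y ∧ φ.order.le m z := by
    rcases φ.total s hs x hx y hy with h₁ | h₁ <;> rcases φ.total s hs y hy z hz with h₂ | h₂ <;>
      rcases φ.total s hs x hx z hz with h₃ | h₃
    all_goals first
      | exact ⟨x, .inl rfl, le_refl x, h₁, h₃⟩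
      | exact ⟨y, .inr (.inl rfl), h₁, le_refl y, h₂⟩
      | exact ⟨z, .inr (.inr rfl), h₃, h₂, le_refl z⟩
      | exact ⟨y, .inr (.inl rfl), h₁, le_refl y, le_trans (b := x) h₁ h₃⟩
      | exact ⟨x, .inl rfl, le_refl x, h₁, le_trans (b := y) h₁ h₂⟩
  rw [tripleLabel, dif_pos hex]
  obtain ⟨h₁, h₂, h₃, h₄⟩ := hex.choose_spec
  generalize hex.choose = n at *
  have hn : n ∈ s := by rcases h₁ with rfl | rfl | rfl <;> assumption
  have hmn : m ≤ n := by rcases h₁ with rfl | rfl | rfl <;> assumption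
  have h := coneLabel_cocycle 𝒞 (q := φ.pairLabel m) (h := φ.minLabel m) (p := φ.pairLabel)
    (x := n) (y := x) (z := y) (t := z) (φ.bd_minLabel hs hm hn hx hmn hmx)
  rw [φ.coneLabel_eq_minLabel hs hm hn hx hz hmn h₂ h₄,
    φ.coneLabel_eq_minLabel hs hm hn hy hz hmn h₃ h₄,
    φ.coneLabel_eq_minLabel hs hm hn hx hy hmn h₂ h₃] at h
  rw [coneLabel, inv_smul_eq_iff, mul_assoc, inv_mul_eq_iff_eq_mul, h]

/-- A formal map extends to a cocycle on all ordered tuples of vertices that span a simplex. -/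
theorem exists_isCocycleOn : ∃ (p : V → V → P) (c : V → V → V → C),
    𝒞.IsCocycleOn {U | ∃ s ∈ K.faces, U = ↑s} p c ∧ φ.HasLabels p c := by
  let := φ.order
  have hmin : ∀ s ∈ K.faces, ∃ m ∈ s, ∀ x ∈ s, φ.order.le m x := by
    intro s hs
    obtain ⟨m, hm⟩ := s.exists_minimal (K.isRelLowerSet_faces hs).1
    refine ⟨m, hm.1, fun x hx => ?_⟩
    rcases φ.total s hs m hm.1 x hx with h | h
    · exact h
    · exact hm.2 hx h
  refine ⟨φ.pairLabel, φ.tripleLabel, ⟨?_, ?_, ?_⟩, ⟨?_, ?_⟩⟩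
  · intro U _ x _
    exact φ.pairLabel_self x
  · rintro _ ⟨s, hs, rfl⟩ x hx y hy z hz
    obtain ⟨m, hm, hle⟩ := hmin s hs
    rw [φ.tripleLabel_eq hs hm hx hy hz (hle x hx) (hle y hy) (hle z hz)]
    exact bd_coneLabel 𝒞 (φ.bd_minLabel hs hm hx hy (hle x hx) (hle y hy))
      (φ.bd_minLabel hs hm hx hz (hle x hx) (hle z hz))
      (φ.bd_minLabel hs hm hy hz (hle y hy) (hle z hz))
  · rintro _ ⟨s, hs, rfl⟩ x hx y hy z hz t ht
    obtain ⟨m, hm, hle⟩ := hmin s hs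
    rw [φ.tripleLabel_eq hs hm hx hy hz (hle x hx) (hle y hy) (hle z hz),
      φ.tripleLabel_eq hs hm hx hz ht (hle x hx) (hle z hz) (hle t ht),
      φ.tripleLabel_eq hs hm hx hy ht (hle x hx) (hle y hy) (hle t ht),
      φ.tripleLabel_eq hs hm hy hz ht (hle y hy) (hle z hz) (hle t ht)]
    exact coneLabel_cocycle 𝒞 (φ.bd_minLabel hs hm hx hy (hle x hx) (hle y hy))
  · intro x y hxy e he
    rw [φ.p_eq_edgeLabel e he, pairLabel, if_pos hxy]
  · intro x y z hxy hyz t ht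
    have hmem : ∀ a, a = x ∨ a = y ∨ a = z → a ∈ t.1 := fun a ha => by
      have : a ∈ (t.1 : Set V) := by rw [ht]; simpa using ha
      exact this
    rw [φ.c_eq_triLabel t ht, φ.tripleLabel_eq t.2.1 (m := x) (hmem x (by simp)) (hmem x (by simp))
      (hmem y (by simp)) (hmem z (by simp)) (le_refl x) (le_of_lt hxy)
      (le_of_lt (lt_trans (b := y) hxy hyz)), coneLabel]
    simp only [minLabel_left, pairLabel_self, inv_one, one_mul, mul_one, one_smul]
    rw [minLabel, if_pos ⟨hxy, hyz⟩]

end FormalMap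

/-! ### Barycentric subdivision of affine chains -/

namespace AffineChain

open FreeAbelianGroup

section Algebra

variable {E : Type*}

/-- The cone operator, which adds the vertex `b` in front of every simplex. -/
def cone (b : E) : FreeAbelianGroup (List E) →+ FreeAbelianGroup (List E) :=
  FreeAbelianGroup.map (List.cons b)

/-- The boundary of the simplex with the given list of vertices, in the augmented complex: the
boundary of `[x]` is the empty simplex `[]`. -/
def boundaryList : List E → FreeAbelianGroup (List E)
  | [] => 0
  | x :: l => of l - cone x (boundaryList l)

/-- The boundary operator of the augmented complex of ordered chains. -/
def boundary : FreeAbelianGroup (List E) →+ FreeAbelianGroup (List E) :=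
  lift boundaryList

@[simp]
theorem cone_of (b : E) (l : List E) : cone b (of l) = of (b :: l) :=
  FreeAbelianGroup.map_of_apply _

@[simp]
theorem boundary_of (l : List E) : boundary (of l) = boundaryList l :=
  lift_apply_of _ _

theorem boundary_cone (b : E) (c : FreeAbelianGroup (List E)) :
    boundary (cone b c) = c - cone b (boundary c) := by
  have : boundary.comp (cone b) =
      AddMonoidHom.id _ - (cone b).comp boundary := by
    ext l
    simp [boundaryList]
  exact DFunLike.congr_fun this c

theorem boundary_boundaryList (l : List E) : boundary (boundaryList l) = 0 := by
  induction l with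
  | nil => simp [boundaryList]
  | cons x l ih => simp [boundaryList, boundary_cone, ih]

/-- The chains generated by a set of simplices. -/
def chains (Q : Set (List E)) : AddSubgroup (FreeAbelianGroup (List E)) :=
  AddSubgroup.closure (of '' Q)

theorem of_mem_chains {Q : Set (List E)} {l : List E} (hl : l ∈ Q) : of l ∈ chains Q :=
  AddSubgroup.subset_closure ⟨l, hl, rfl⟩

theorem chains_mono {Q R : Set (List E)} (h : Q ⊆ R) : chains Q ≤ chains R :=
  AddSubgroup.closure_mono (Set.image_mono h)

theorem map_mem_of_mem_chains {G : Type*} [AddCommGroup G] {Q : Set (List E)}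
    (f : FreeAbelianGroup (List E) →+ G) (H : AddSubgroup G) (h : ∀ l ∈ Q, f (of l) ∈ H)
    {c : FreeAbelianGroup (List E)} (hc : c ∈ chains Q) : f c ∈ H := by
  have : chains Q ≤ H.comap f := by
    rw [chains, AddSubgroup.closure_le]
    rintro _ ⟨l, hl, rfl⟩
    exact h l hl
  exact this hc

theorem eq_of_mem_chains {G : Type*} [AddCommGroup G] {Q : Set (List E)}
    (f g : FreeAbelianGroup (List E) →+ G) (h : ∀ l ∈ Q, f (of l) = g (of l))
    {c : FreeAbelianGroup (List E)} (hc : c ∈ chains Q) : f c = g c := by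
  have := map_mem_of_mem_chains (f - g) ⊥ (fun l hl => by simp [h l hl]) hc
  simpa [sub_eq_zero] using this

/-- The ordered simplices with `n` vertices, all of which lie in `U`. -/
def simplicesIn (U : Set E) (n : ℕ) : Set (List E) :=
  {l | l.length = n ∧ ∀ x ∈ l, x ∈ U}

theorem simplicesIn_mono {U U' : Set E} (h : U ⊆ U') (n : ℕ) :
    simplicesIn U n ⊆ simplicesIn U' n :=
  fun _ hl => ⟨hl.1, fun x hx => h (hl.2 x hx)⟩

theorem cone_mem_chains {U : Set E} {n : ℕ} {b : E} (hb : b ∈ U)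
    {c : FreeAbelianGroup (List E)} (hc : c ∈ chains (simplicesIn U n)) :
    cone b c ∈ chains (simplicesIn U (n + 1)) := by
  refine map_mem_of_mem_chains _ _ (fun l hl => ?_) hc
  rw [cone_of]
  exact of_mem_chains ⟨by simp [hl.1], by simpa [hb] using hl.2⟩

/-- The boundary of a simplex consists of simplices on its set of vertices. -/
theorem boundaryList_mem_chains {U : Set E} {n : ℕ} {l : List E}
    (hl : l ∈ simplicesIn U (n + 1)) : boundaryList l ∈ chains (simplicesIn U n) := by
  induction n generalizing l with
  | zero =>
    obtain ⟨x, rfl⟩ := List.length_eq_one_iff.1 hl.1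
    simpa [boundaryList] using of_mem_chains (Q := simplicesIn U 0) ⟨rfl, by simp⟩
  | succ n ih =>
    obtain ⟨hl₁, hl₂⟩ := hl
    match l, hl₁, hl₂ with
    | x :: l, hl₁, hl₂ =>
      have hl : l ∈ simplicesIn U (n + 1) :=
        ⟨by simpa using hl₁, fun y hy => hl₂ y (List.mem_cons_of_mem _ hy)⟩
      exact sub_mem (of_mem_chains hl) (cone_mem_chains (hl₂ x List.mem_cons_self) (ih hl))

end Algebra

variable {E : Type*} [AddCommGroup E] [Module ℝ E]

/-- The barycentre of a simplex. -/
noncomputable def barycenter (l : List E) : E :=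
  (l.length : ℝ)⁻¹ • l.sum

/-- Barycentric subdivision of simplices with `n` vertices. -/
noncomputable def sd : ℕ → FreeAbelianGroup (List E) →+ FreeAbelianGroup (List E)
  | 0 => AddMonoidHom.id _
  | n + 1 => lift fun l => cone (barycenter l) (sd n (boundaryList l))

/-- The chain homotopy between the identity and barycentric subdivision, on simplices with `n`
vertices. -/
noncomputable def sdHomotopy : ℕ → FreeAbelianGroup (List E) →+ FreeAbelianGroup (List E)
  | 0 => 0
  | n + 1 => lift fun l => cone (barycenter l) (of l - sdHomotopy n (boundaryList l))

theorem sd_succ_of (n : ℕ) (l : List E) :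
    sd (n + 1) (of l) = cone (barycenter l) (sd n (boundaryList l)) :=
  lift_apply_of _ _

theorem sdHomotopy_succ_of (n : ℕ) (l : List E) : sdHomotopy (n + 1) (of l) =
    cone (barycenter l) (of l - sdHomotopy n (boundaryList l)) :=
  lift_apply_of _ _

theorem boundary_sd (n : ℕ) (c : FreeAbelianGroup (List E)) :
    boundary (sd (n + 1) c) = sd n (boundary c) := by
  suffices boundary.comp (sd (n + 1)) = (sd n).comp (boundary (E := E)) from
    DFunLike.congr_fun this c
  induction n with
  | zero =>
    ext l
    simp [boundary_cone, boundary_boundaryList, sd]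
  | succ n ih =>
    ext l
    have : boundary (sd (n + 1) (boundaryList l)) = sd n (boundary (boundaryList l)) :=
      DFunLike.congr_fun ih _
    rw [AddMonoidHom.comp_apply, AddMonoidHom.comp_apply, sd_succ_of, boundary_cone, this,
      boundary_boundaryList, boundary_of]
    simp

theorem boundary_sdHomotopy (n : ℕ) (c : FreeAbelianGroup (List E)) :
    boundary (sdHomotopy (n + 1) c) = c - sdHomotopy n (boundary c) - sd (n + 1) c := by
  suffices boundary.comp (sdHomotopy (n + 1)) =
      AddMonoidHom.id (FreeAbelianGroup (List E)) - (sdHomotopy n).comp boundary - sd (n + 1) from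
    DFunLike.congr_fun this c
  induction n with
  | zero =>
    ext l
    simp [boundaryList, sdHomotopy, sd]
  | succ n ih =>
    ext l
    have : boundary (sdHomotopy (n + 1) (boundaryList l)) =
        boundaryList l - sdHomotopy n (boundary (boundaryList l)) - sd (n + 1) (boundaryList l) :=
      DFunLike.congr_fun ih _
    simp only [AddMonoidHom.comp_apply, AddMonoidHom.sub_apply, AddMonoidHom.id_apply]
    rw [sdHomotopy_succ_of, boundary_cone, map_sub boundary, this, boundary_boundaryList,
      boundary_of, sd_succ_of]
    simp

theorem barycenter_mem {U : Set E} (hU : Convex ℝ U) {l : List E} (hl : l ≠ [])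
    (h : ∀ x ∈ l, x ∈ U) : barycenter l ∈ U := by
  have hlen : (l.length : ℝ) ≠ 0 := by simpa using hl
  have : barycenter l = ∑ i : Fin l.length, (l.length : ℝ)⁻¹ • l.get i := by
    rw [barycenter, ← Finset.smul_sum]
    congr 1
    simp [← List.sum_ofFn]
  rw [this]
  refine hU.sum_mem (fun _ _ => by positivity) ?_ (fun i _ => h _ (List.get_mem _ _))
  simp [hlen]

theorem sd_mem_chains {U : Set E} (hU : Convex ℝ U) {n : ℕ} {c : FreeAbelianGroup (List E)}
    (hc : c ∈ chains (simplicesIn U n)) : sd n c ∈ chains (simplicesIn U n) := by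
  induction n generalizing c with
  | zero => exact hc
  | succ n ih =>
    refine map_mem_of_mem_chains _ _ (fun l hl => ?_) hc
    rw [sd_succ_of]
    exact cone_mem_chains (barycenter_mem hU (by rintro rfl; simp [simplicesIn] at hl) hl.2)
      (ih (boundaryList_mem_chains hl))

theorem sdHomotopy_mem_chains {U : Set E} (hU : Convex ℝ U) {n : ℕ}
    {c : FreeAbelianGroup (List E)} (hc : c ∈ chains (simplicesIn U n)) :
    sdHomotopy n c ∈ chains (simplicesIn U (n + 1)) := by
  induction n generalizing c with
  | zero => exact zero_mem _
  | succ n ih =>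
    refine map_mem_of_mem_chains _ _ (fun l hl => ?_) hc
    rw [sdHomotopy_succ_of]
    exact cone_mem_chains (barycenter_mem hU (by rintro rfl; simp [simplicesIn] at hl) hl.2)
      (sub_mem (of_mem_chains hl) (ih (boundaryList_mem_chains hl)))

/-- The simplices in `U` with `n` vertices whose diameter with respect to the seminorm `q` is at
most `d`. -/
def fineSimplices (q : Seminorm ℝ E) (U : Set E) (n : ℕ) (d : ℝ) : Set (List E) :=
  {l | l ∈ simplicesIn U n ∧ ∀ x ∈ l, ∀ y ∈ l, q (x - y) ≤ d}

theorem seminorm_sub_barycenter_le (q : Seminorm ℝ E) {l : List E} {d : ℝ} {x : E} (hx : x ∈ l)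
    (hd : ∀ x ∈ l, ∀ y ∈ l, q (x - y) ≤ d) :
    q (x - barycenter l) ≤ (1 - (l.length : ℝ)⁻¹) * d := by
  have hl : l ≠ [] := List.ne_nil_of_mem hx
  have hn : (0 : ℝ) < l.length := by
    have := List.length_pos_of_ne_nil hl
    exact_mod_cast this
  have hsum : ∀ m : List E, q ((m.map fun y => x - y).sum) ≤ (m.map fun y => q (x - y)).sum := by
    intro m
    induction m with
    | nil => simp
    | cons y m ih => simpa using (map_add_le_add q _ _).trans (add_le_add_right ih _)
  have hle : ∀ m : List E, (∀ y ∈ m, q (x - y) ≤ d) →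
      (m.map fun y => q (x - y)).sum ≤ m.length * d := by
    intro m hm
    induction m with
    | nil => simp
    | cons y m ih =>
      have h₁ := hm y List.mem_cons_self
      have h₂ := ih fun z hz => hm z (List.mem_cons_of_mem _ hz)
      simp only [List.map_cons, List.sum_cons, List.length_cons]
      push_cast
      linarith
  have heq : ∀ m : List E, (m.map fun y => x - y).sum = (m.length : ℝ) • x - m.sum := by
    intro m
    induction m with
    | nil => simp
    | cons y m ih =>
      simp only [List.map_cons, List.sum_cons, ih, List.length_cons]
      push_cast
      module
  have hb : x - barycenter l = (l.length : ℝ)⁻¹ • (l.map fun y => x - y).sum := by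
    rw [heq, smul_sub, smul_smul, inv_mul_cancel₀ hn.ne', one_smul, barycenter]
  -- the summand of `x` itself vanishes, so that only `l.length - 1` of them count
  have hle' : (l.map fun y => q (x - y)).sum ≤ (l.length - 1) * d := by
    obtain ⟨s, t, rfl⟩ := List.append_of_mem hx
    have h₁ := hle s fun y hy => hd x hx y (by simp [hy])
    have h₂ := hle t fun y hy => hd x hx y (by simp [hy])
    simp only [List.map_append, List.sum_append, List.map_cons, List.sum_cons, sub_self, map_zero,
      List.length_append, List.length_cons]
    push_cast
    linarith
  rw [hb, map_smul_eq_mul, Real.norm_of_nonneg (by positivity)]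
  calc (l.length : ℝ)⁻¹ * q ((l.map fun y => x - y).sum)
      ≤ (l.length : ℝ)⁻¹ * ((l.length - 1) * d) := by
        gcongr
        exact (hsum l).trans hle'
    _ = (1 - (l.length : ℝ)⁻¹) * d := by field_simp

/-- Barycentric subdivision of simplices with at most four vertices shrinks diameters by the
factor `3 / 4`. -/
theorem sd_of_mem_chains_fineSimplices (q : Seminorm ℝ E) {n : ℕ} (hn : n ≤ 4) {d : ℝ}
    (hd : 0 ≤ d) {l : List E} (hl : l ∈ fineSimplices q Set.univ n d) :
    sd n (of l) ∈ chains (fineSimplices q (convexHull ℝ {x | x ∈ l}) n (3 / 4 * d)) := by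
  induction n generalizing l with
  | zero =>
    have : l = [] := List.length_eq_zero_iff.1 hl.1.1
    subst this
    exact of_mem_chains ⟨⟨rfl, by simp⟩, by simp⟩
  | succ n ih =>
    have hl₀ : l ≠ [] := by
      rintro rfl
      simp [fineSimplices, simplicesIn] at hl
    set W : Set E := convexHull ℝ {x | x ∈ l} with hW
    have hb : barycenter l ∈ W :=
      barycenter_mem (convex_convexHull ℝ _) hl₀ fun x hx => subset_convexHull ℝ _ hx
    have hball : ∀ y ∈ W, q (y - barycenter l) ≤ 3 / 4 * d := by
      intro y hy
      have : W ⊆ q.closedBall (barycenter l) (3 / 4 * d) := by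
        refine convexHull_min (fun x hx => ?_) (q.convex_closedBall _ _)
        rw [Seminorm.mem_closedBall]
        refine (seminorm_sub_barycenter_le q hx hl.2).trans ?_
        gcongr
        rw [hl.1.1]
        have h₄ : ((n + 1 : ℕ) : ℝ) ≤ 4 := by exact_mod_cast hn
        have : (4 : ℝ)⁻¹ ≤ ((n + 1 : ℕ) : ℝ)⁻¹ := by gcongr
        linarith
      exact Seminorm.mem_closedBall q |>.1 (this hy)
    rw [sd_succ_of]
    have hface : boundaryList l ∈ chains {m | m ∈ simplicesIn {x | x ∈ l} n} :=
      boundaryList_mem_chains ⟨hl.1.1, fun x hx => hx⟩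
    have hsd : sd n (boundaryList l) ∈ chains (fineSimplices q W n (3 / 4 * d)) := by
      refine map_mem_of_mem_chains _ _ (fun m hm => ?_) hface
      have hm' : m ∈ fineSimplices q Set.univ n d :=
        ⟨⟨hm.1, fun _ _ => trivial⟩, fun x hx y hy => hl.2 x (hm.2 x hx) y (hm.2 y hy)⟩
      refine chains_mono ?_ (ih (by omega) hm')
      exact fun m' hm' =>
        ⟨simplicesIn_mono (convexHull_mono fun x hx => hm.2 x hx) _ hm'.1, hm'.2⟩
    refine map_mem_of_mem_chains _ _ (fun m hm => ?_) hsd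
    rw [cone_of]
    refine of_mem_chains ⟨⟨by simp [hm.1.1], by simpa [hb] using hm.1.2⟩, ?_⟩
    intro x hx y hy
    rcases List.mem_cons.1 hx with rfl | hx <;> rcases List.mem_cons.1 hy with rfl | hy
    · simpa using hd
    · rw [map_sub_rev]
      exact hball y (hm.1.2 y hy)
    · exact hball x (hm.1.2 x hx)
    · exact hm.2 x hx y hy

theorem sd_iterate_mem_chains_fineSimplices (q : Seminorm ℝ E) {n : ℕ} (hn : n ≤ 4) {d : ℝ}
    (hd : 0 ≤ d) {U : Set E} (hU : Convex ℝ U) {l : List E} (hl : l ∈ fineSimplices q U n d)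
    (N : ℕ) : (sd n)^[N] (of l) ∈ chains (fineSimplices q U n ((3 / 4) ^ N * d)) := by
  induction N with
  | zero => simpa using of_mem_chains hl
  | succ N ih =>
    rw [Function.iterate_succ_apply']
    refine map_mem_of_mem_chains _ _ (fun m hm => ?_) ih
    have := sd_of_mem_chains_fineSimplices q hn (d := (3 / 4) ^ N * d) (by positivity)
      (l := m) ⟨⟨hm.1.1, fun _ _ => trivial⟩, hm.2⟩
    rw [← mul_assoc, ← pow_succ'] at this
    refine chains_mono ?_ this
    exact fun m' hm' => ⟨simplicesIn_mono (convexHull_min hm.1.2 hU) _ hm'.1, hm'.2⟩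

/-- The family `𝓨` of convex sets is *locally fine* in the family `𝓩` if every set of `𝓩` is
covered by sets of `𝓨` that are cut out by balls of a fixed radius of some seminorm. -/
structure IsFineIn (𝓨 𝓩 : Set (Set E)) : Prop where
  convex_left : ∀ U ∈ 𝓨, Convex ℝ U
  convex_right : ∀ S ∈ 𝓩, Convex ℝ S
  exists_ball : ∀ S ∈ 𝓩, ∃ (q : Seminorm ℝ E) (δ : ℝ), 0 < δ ∧ ∀ x ∈ S, S ∩ q.ball x δ ∈ 𝓨

/-- Every simplex in a set of `𝓩` becomes a chain of simplices in sets of `𝓨` after sufficiently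
many barycentric subdivisions. -/
theorem IsFineIn.exists_sd_iterate_mem {𝓨 𝓩 : Set (Set E)} (h : IsFineIn 𝓨 𝓩) {S : Set E}
    (hS : S ∈ 𝓩) {n : ℕ} (hn₀ : n ≠ 0) (hn : n ≤ 4) {l : List E} (hl : l ∈ simplicesIn S n) :
    ∃ N, ∀ i ≥ N, (sd n)^[i] (of l) ∈ chains {m | ∃ U ∈ 𝓨, m ∈ simplicesIn U n} := by
  obtain ⟨q, δ, hδ, hball⟩ := h.exists_ball S hS
  obtain ⟨d, hd⟩ : ∃ d, ∀ x ∈ l, ∀ y ∈ l, q (x - y) ≤ d := by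
    have hfin : (Set.image2 (fun x y => q (x - y)) {x | x ∈ l} {x | x ∈ l}).Finite :=
      (List.finite_toSet l).image2 _ (List.finite_toSet l)
    obtain ⟨d, hd⟩ := hfin.bddAbove
    exact ⟨d, fun x hx y hy => hd ⟨x, hx, y, hy, rfl⟩⟩
  have hd₀ : 0 ≤ d := by
    obtain ⟨x, hx⟩ := List.exists_mem_of_ne_nil l
      (by rintro rfl; exact hn₀ hl.1.symm)
    exact (apply_nonneg q _).trans (hd x hx x hx)
  have hlim : Filter.Tendsto (fun N : ℕ => (3 / 4 : ℝ) ^ N * d) Filter.atTop (nhds 0) := by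
    simpa using (tendsto_pow_atTop_nhds_zero_of_lt_one (by norm_num : (0 : ℝ) ≤ 3 / 4)
      (by norm_num)).mul_const d
  obtain ⟨N, hN⟩ := Filter.eventually_atTop.1 (hlim.eventually_lt_const hδ)
  refine ⟨N, fun i hi => chains_mono ?_
    (sd_iterate_mem_chains_fineSimplices q hn hd₀ (h.convex_right S hS) ⟨hl, hd⟩ i)⟩
  intro m hm
  obtain ⟨x, hx⟩ := List.exists_mem_of_ne_nil m
    (by rintro rfl; exact hn₀ hm.1.1.symm)
  refine ⟨_, hball x (hm.1.2 x hx), hm.1.1, fun y hy => ⟨hm.1.2 y hy, ?_⟩⟩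
  rw [Seminorm.mem_ball]
  exact (hm.2 y hy x hx).trans_lt (hN i hi)

variable {A G : Type*} [AddCommGroup A] [Group G] [DistribMulAction G A]

/-- The cochain `k`, with values in the local system `ρ`, transported to the fibre at `x`. -/
def transport (ρ : E → E → G) (k : E → E → E → E → A) (x : E) : List E → A
  | [a, b, c, d] => ρ x a • k a b c d
  | _ => 0

/-- The third cohomology of `𝓩` relative to `𝓨`, with coefficients in a local system `ρ`, vanishes.
The primitive of `k` is `∑ i, k ∘ sdHomotopy ∘ sd ^ i`, a sum which is finite because `k` vanishes
on simplices in sets of `𝓨`. -/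
theorem IsFineIn.exists_primitive {𝓨 𝓩 : Set (Set E)} (h : IsFineIn 𝓨 𝓩) (ρ : E → E → G)
    (k : E → E → E → E → A)
    (hρ_self : ∀ S ∈ 𝓩, ∀ x ∈ S, ∀ a : A, ρ x x • a = a)
    (hρ : ∀ S ∈ 𝓩, ∀ x ∈ S, ∀ y ∈ S, ∀ z ∈ S, ∀ a : A, ρ x y • ρ y z • a = ρ x z • a)
    (hk : ∀ S ∈ 𝓩, ∀ x ∈ S, ∀ y ∈ S, ∀ z ∈ S, ∀ t ∈ S, ∀ r ∈ S,
      ρ x y • k y z t r - k x z t r + k x y t r - k x y z r + k x y z t = 0)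
    (hk₀ : ∀ U ∈ 𝓨, ∀ x ∈ U, ∀ y ∈ U, ∀ z ∈ U, ∀ t ∈ U, k x y z t = 0) :
    ∃ a : E → E → E → A,
      (∀ S ∈ 𝓩, ∀ x ∈ S, ∀ y ∈ S, ∀ z ∈ S, ∀ t ∈ S,
        ρ x y • a y z t - a x z t + a x y t - a x y z = k x y z t) ∧
      ∀ U ∈ 𝓨, ∀ x ∈ U, ∀ y ∈ U, ∀ z ∈ U, a x y z = 0 := by
  let κ : E → FreeAbelianGroup (List E) →+ A := fun x => lift (transport ρ k x)
  have hκ_of : ∀ x a b c d, κ x (of [a, b, c, d]) = ρ x a • k a b c d := fun x a b c d => by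
    simp [κ, transport]
  let term : E → FreeAbelianGroup (List E) → ℕ → A := fun x c i =>
    κ x (sdHomotopy 3 ((sd 3)^[i] c))
  have hκ_zero : ∀ x {c}, c ∈ chains {m | ∃ U ∈ 𝓨, m ∈ simplicesIn U 4} → κ x c = 0 := by
    intro x c hc
    refine eq_of_mem_chains _ 0 (fun l hl => ?_) hc
    obtain ⟨U, hU, hl₁, hl₂⟩ := hl
    match l, hl₁ with
    | [a, b, c, d], _ =>
      rw [hκ_of, hk₀ U hU a (hl₂ a (by simp)) b (hl₂ b (by simp)) c (hl₂ c (by simp)) d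
        (hl₂ d (by simp)), smul_zero]
      rfl
  have hterm_zero : ∀ x {c}, c ∈ chains {m | ∃ U ∈ 𝓨, m ∈ simplicesIn U 3} →
      κ x (sdHomotopy 3 c) = 0 := by
    intro x c hc
    refine hκ_zero x (map_mem_of_mem_chains _ _ (fun l hl => ?_) hc)
    obtain ⟨U, hU, hl⟩ := hl
    refine chains_mono ?_ (sdHomotopy_mem_chains (h.convex_left U hU) (of_mem_chains hl))
    exact fun m hm => ⟨U, hU, hm⟩
  have hκ_smul : ∀ S ∈ 𝓩, ∀ x ∈ S, ∀ y ∈ S, ∀ {c}, c ∈ chains (simplicesIn S 4) →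
      ρ x y • κ y c = κ x c := by
    intro S hS x hx y hy c hc
    refine eq_of_mem_chains ((DistribSMul.toAddMonoidHom A (ρ x y)).comp (κ y)) _
      (fun l hl => ?_) hc
    obtain ⟨hl₁, hl₂⟩ := hl
    match l, hl₁ with
    | [a, b, c, d], _ =>
      simp only [AddMonoidHom.comp_apply, hκ_of]
      exact hρ S hS x hx y hy a (hl₂ a (by simp)) _
  have hκ_boundary : ∀ S ∈ 𝓩, ∀ x ∈ S, ∀ {c}, c ∈ chains (simplicesIn S 5) →
      κ x (boundary c) = 0 := by
    intro S hS x hx c hc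
    refine eq_of_mem_chains ((κ x).comp boundary) 0 (fun l hl => ?_) hc
    obtain ⟨hl₁, hl₂⟩ := hl
    match l, hl₁ with
    | [a, b, c, d, e], _ =>
      have ha := hl₂ a (by simp)
      have hb := hl₂ b (by simp)
      have := hk S hS a ha b hb c (hl₂ c (by simp)) d (hl₂ d (by simp)) e (hl₂ e (by simp))
      simp only [AddMonoidHom.comp_apply, boundary_of, boundaryList, map_sub, cone_of, hκ_of,
        map_zero, sub_zero, AddMonoidHom.zero_apply]
      rw [← hρ S hS x hx a ha b hb, ← smul_sub, ← smul_sub, ← smul_sub, ← smul_sub]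
      refine (congrArg _ ?_).trans (smul_zero (ρ x a))
      rw [← this]
      abel
  have hiter : ∀ (n i : ℕ) (c : FreeAbelianGroup (List E)),
      boundary ((sd (n + 1))^[i] c) = (sd n)^[i] (boundary c) := by
    intro n i c
    induction i with
    | zero => rfl
    | succ i ih => rw [Function.iterate_succ_apply', Function.iterate_succ_apply', boundary_sd, ih]
  have hiter_mem : ∀ {S : Set E}, Convex ℝ S → ∀ (n i : ℕ) {c : FreeAbelianGroup (List E)},
      c ∈ chains (simplicesIn S n) → (sd n)^[i] c ∈ chains (simplicesIn S n) := by
    intro S hS n i c hc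
    induction i with
    | zero => exact hc
    | succ i ih =>
      rw [Function.iterate_succ_apply']
      exact sd_mem_chains hS ih
  have hiter_sub : ∀ (i : ℕ) (c d : FreeAbelianGroup (List E)),
      (sd 3)^[i] (c - d) = (sd 3)^[i] c - (sd 3)^[i] d := by
    intro i c d
    induction i with
    | zero => rfl
    | succ i ih => simp only [Function.iterate_succ_apply', ih, map_sub]
  have hterm_sub : ∀ x c d i, term x (c - d) i = term x c i - term x d i := by
    intro x c d i
    simp only [term, hiter_sub, map_sub]
  refine ⟨fun x y z => ∑ᶠ i, term x (of [x, y, z]) i, ?_, ?_⟩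
  · intro S hS x hx y hy z hz t ht
    have hconv := h.convex_right S hS
    have hev : ∀ a ∈ S, ∀ b ∈ S, ∀ c ∈ S, ∃ N, ∀ i ≥ N, ∀ x, term x (of [a, b, c]) i = 0 := by
      intro a ha b hb c hc
      obtain ⟨N, hN⟩ := h.exists_sd_iterate_mem hS (n := 3) (l := [a, b, c]) (by norm_num)
        (by norm_num) ⟨rfl, by simp [*]⟩
      exact ⟨N, fun i hi x => hterm_zero x (hN i hi)⟩
    obtain ⟨N₀, hN₀⟩ := hev y hy z hz t ht
    obtain ⟨N₁, hN₁⟩ := hev x hx z hz t ht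
    obtain ⟨N₂, hN₂⟩ := hev x hx y hy t ht
    obtain ⟨N₃, hN₃⟩ := hev x hx y hy z hz
    have hl : [x, y, z, t] ∈ simplicesIn S 4 := ⟨rfl, by simp [*]⟩
    obtain ⟨N₄, hN₄⟩ := h.exists_sd_iterate_mem hS (n := 4) (by norm_num) le_rfl hl
    let N := N₀ + N₁ + N₂ + N₃ + N₄
    have hsum : ∀ (w a b c : E) (M : ℕ), (∀ i ≥ M, ∀ x, term x (of [a, b, c]) i = 0) → M ≤ N →
        ∑ᶠ i, term w (of [a, b, c]) i = ∑ i ∈ Finset.range N, term w (of [a, b, c]) i := by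
      intro w a b c M hM hMN
      refine finsum_eq_sum_of_support_subset _ fun i hi => ?_
      by_contra hiN
      exact hi (hM i (hMN.trans (by simpa using hiN)) w)
    beta_reduce
    rw [hsum y y z t N₀ hN₀ (by omega), hsum x x z t N₁ hN₁ (by omega),
      hsum x x y t N₂ hN₂ (by omega), hsum x x y z N₃ hN₃ (by omega)]
    have hbase : ρ x y • ∑ i ∈ Finset.range N, term y (of [y, z, t]) i =
        ∑ i ∈ Finset.range N, term x (of [y, z, t]) i := by
      rw [Finset.smul_sum]
      refine Finset.sum_congr rfl fun i _ => hκ_smul S hS x hx y hy ?_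
      exact sdHomotopy_mem_chains hconv (hiter_mem hconv 3 i (of_mem_chains ⟨rfl, by simp [*]⟩))
    have hstep : ∀ i, term x (boundaryList [x, y, z, t]) i =
        κ x ((sd 4)^[i] (of [x, y, z, t])) - κ x ((sd 4)^[i + 1] (of [x, y, z, t])) := by
      intro i
      have hmem := hiter_mem hconv 4 i (of_mem_chains hl)
      have h₀ := hκ_boundary S hS x hx (sdHomotopy_mem_chains hconv hmem)
      rw [boundary_sdHomotopy, hiter, boundary_of, map_sub, map_sub, sub_right_comm,
        sub_eq_zero] at h₀
      rw [Function.iterate_succ_apply']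
      exact h₀.symm
    have hsplit : ∀ i, term x (boundaryList [x, y, z, t]) i = term x (of [y, z, t]) i -
        term x (of [x, z, t]) i + term x (of [x, y, t]) i - term x (of [x, y, z]) i := by
      intro i
      simp only [boundaryList, map_sub, cone_of, map_zero, sub_zero, hterm_sub]
      abel
    rw [hbase, ← Finset.sum_sub_distrib, ← Finset.sum_add_distrib, ← Finset.sum_sub_distrib,
      ← Finset.sum_congr rfl fun i _ => hsplit i, Finset.sum_congr rfl fun i _ => hstep i,
      Finset.sum_range_sub', hκ_zero x (hN₄ N (by omega)), sub_zero, Function.iterate_zero, id,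
      hκ_of, hρ_self S hS x hx]
  · intro U hU x hx y hy z hz
    refine (finsum_congr fun i => hterm_zero x ?_).trans finsum_zero
    refine chains_mono ?_
      (hiter_mem (h.convex_left U hU) 3 i (of_mem_chains (l := [x, y, z]) ⟨rfl, by simp [*]⟩))
    exact fun m hm => ⟨U, hU, hm⟩

end AffineChain

/-! ### Extension of cocycles from small to large tuples -/

namespace AffineChain

variable {E : Type*} [AddCommGroup E] [Module ℝ E]

/-- A locally defined functor with values in a group extends to the sets of `𝓩`: the value on a
pair of points is obtained by transport along the segment between them. -/
theorem IsFineIn.exists_functor {G : Type*} [Group G] {𝓨 𝓩 : Set (Set E)} (h : IsFineIn 𝓨 𝓩)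
    (π₀ : E → E → G)
    (hπ₀ : ∀ U ∈ 𝓨, ∀ x ∈ U, ∀ y ∈ U, ∀ z ∈ U, π₀ x y * π₀ y z = π₀ x z) :
    ∃ π : E → E → G,
      (∀ S ∈ 𝓩, ∀ x ∈ S, ∀ y ∈ S, ∀ z ∈ S, π x y * π y z = π x z) ∧
      ∀ U ∈ 𝓨, ∀ x ∈ U, ∀ y ∈ U, π x y = π₀ x y := by
  let halve : (E → E → G) → E → E → G := fun f x y => f x (midpoint ℝ x y) * f (midpoint ℝ x y) y
  let πs : ℕ → E → E → G := fun i => halve^[i] π₀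
  have hsucc : ∀ i x y, πs (i + 1) x y =
      πs i x (midpoint ℝ x y) * πs i (midpoint ℝ x y) y := by
    intro i x y
    simp only [πs, Function.iterate_succ_apply']
    rfl
  have hmid : ∀ {U : Set E}, Convex ℝ U → ∀ {x y}, x ∈ U → y ∈ U → midpoint ℝ x y ∈ U :=
    fun hU _ _ hx hy => hU.midpoint_mem hx hy
  have hsmall : ∀ U ∈ 𝓨, ∀ i, ∀ x ∈ U, ∀ y ∈ U, πs i x y = π₀ x y := by
    intro U hU i
    induction i with
    | zero => intros; rfl
    | succ i ih =>
      intro x hx y hy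
      have hm := hmid (h.convex_left U hU) hx hy
      rw [hsucc, ih x hx _ hm, ih _ hm y hy, hπ₀ U hU x hx _ hm y hy]
  have hhalf : ∀ (q : Seminorm ℝ E) (r : ℝ) (a b : E), a = (1 / 2 : ℝ) • b → q b < 2 * r →
      q a < r := by
    rintro q r _ b rfl hb
    rw [map_smul_eq_mul, Real.norm_of_nonneg (by norm_num)]
    linarith
  -- the transport along a segment does not depend on how finely the segment is subdivided
  have hstable : ∀ S ∈ 𝓩, ∀ x ∈ S, ∀ y ∈ S, ∃ g, ∀ᶠ i in Filter.atTop, πs i x y = g := by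
    intro S hS
    obtain ⟨q, δ, hδ, hball⟩ := h.exists_ball S hS
    have key : ∀ M : ℕ, ∀ x ∈ S, ∀ y ∈ S, q (x - y) < 2 ^ M * δ →
        ∀ i ≥ M, πs i x y = πs M x y := by
      intro M
      induction M with
      | zero =>
        intro x hx y hy hxy i _
        have hx' : x ∈ S ∩ q.ball x δ := ⟨hx, by simpa [Seminorm.mem_ball] using hδ⟩
        have hy' : y ∈ S ∩ q.ball x δ := ⟨hy, by
          rw [Seminorm.mem_ball, map_sub_rev]; simpa using hxy⟩
        rw [hsmall _ (hball x hx) i x hx' y hy', hsmall _ (hball x hx) 0 x hx' y hy']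
      | succ M ih =>
        intro x hx y hy hxy i hi
        obtain ⟨i, rfl⟩ : ∃ j, i = j + 1 := ⟨i - 1, by omega⟩
        have hm := hmid (h.convex_right S hS) hx hy
        rw [pow_succ', mul_assoc] at hxy
        rw [hsucc, hsucc, ih x hx _ hm (hhalf q _ _ (x - y) ?_ hxy) i (by omega),
          ih _ hm y hy (hhalf q _ _ (x - y) ?_ hxy) i (by omega)]
        · rw [midpoint_eq_smul_add, invOf_eq_inv]; module
        · rw [midpoint_eq_smul_add, invOf_eq_inv]; module
    intro x hx y hy
    obtain ⟨M, hM⟩ := pow_unbounded_of_one_lt (q (x - y) / δ) (one_lt_two (α := ℝ))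
    exact ⟨_, Filter.eventually_atTop.2 ⟨M, key M x hx y hy ((div_lt_iff₀ hδ).1 hM)⟩⟩
  have hlim : ∀ x y, ∃ g, (∃ g', ∀ᶠ i in Filter.atTop, πs i x y = g') →
      ∀ᶠ i in Filter.atTop, πs i x y = g := by
    intro x y
    by_cases hxy : ∃ g', ∀ᶠ i in Filter.atTop, πs i x y = g'
    · exact ⟨hxy.choose, fun _ => hxy.choose_spec⟩
    · exact ⟨1, fun h => absurd h hxy⟩
  choose π hπ using hlim
  have hπ_small : ∀ U ∈ 𝓨, ∀ x ∈ U, ∀ y ∈ U, π x y = π₀ x y := by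
    intro U hU x hx y hy
    have hev := hπ x y ⟨π₀ x y, Filter.Eventually.of_forall fun i => hsmall U hU i x hx y hy⟩
    obtain ⟨i, hi⟩ := hev.exists
    rw [← hi, hsmall U hU i x hx y hy]
  have hπ_mid : ∀ S ∈ 𝓩, ∀ x ∈ S, ∀ y ∈ S,
      π x (midpoint ℝ x y) * π (midpoint ℝ x y) y = π x y := by
    intro S hS x hx y hy
    have hm := hmid (h.convex_right S hS) hx hy
    have h₁ := hπ x y (hstable S hS x hx y hy)
    have h₂ := hπ _ _ (hstable S hS x hx _ hm)
    have h₃ := hπ _ _ (hstable S hS _ hm y hy)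
    obtain ⟨i, hi₁, hi₂, hi₃⟩ :=
      (((Filter.tendsto_add_atTop_nat 1).eventually h₁).and (h₂.and h₃)).exists
    rw [← hi₁, hsucc, hi₂, hi₃]
  refine ⟨π, fun S hS => ?_, hπ_small⟩
  obtain ⟨q, δ, hδ, hball⟩ := h.exists_ball S hS
  have key : ∀ M : ℕ, ∀ x ∈ S, ∀ y ∈ S, ∀ z ∈ S, q (x - y) < 2 ^ M * δ → q (y - z) < 2 ^ M * δ →
      q (x - z) < 2 ^ M * δ → π x y * π y z = π x z := by
    intro M
    induction M with
    | zero =>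
      intro x hx y hy z hz hxy _ hxz
      have hx' : x ∈ S ∩ q.ball x δ := ⟨hx, by simpa [Seminorm.mem_ball] using hδ⟩
      have hy' : y ∈ S ∩ q.ball x δ := ⟨hy, by
        rw [Seminorm.mem_ball, map_sub_rev]; simpa using hxy⟩
      have hz' : z ∈ S ∩ q.ball x δ := ⟨hz, by
        rw [Seminorm.mem_ball, map_sub_rev]; simpa using hxz⟩
      rw [hπ_small _ (hball x hx) x hx' y hy', hπ_small _ (hball x hx) x hx' z hz',
        hπ_small _ (hball x hx) y hy' z hz', hπ₀ _ (hball x hx) x hx' y hy' z hz']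
    | succ M ih =>
      -- the midpoints of the edges divide the triangle into four triangles of half its size
      intro x hx y hy z hz hxy hyz hxz
      have hxy_mem := hmid (h.convex_right S hS) hx hy
      have hyz_mem := hmid (h.convex_right S hS) hy hz
      have hxz_mem := hmid (h.convex_right S hS) hx hz
      rw [pow_succ', mul_assoc] at hxy hyz hxz
      have e₁ := ih _ hxy_mem _ hy _ hyz_mem
        (hhalf q _ _ _ (by simp only [midpoint_eq_smul_add, invOf_eq_inv]; module) hxy)
        (hhalf q _ _ _ (by simp only [midpoint_eq_smul_add, invOf_eq_inv]; module) hyz)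
        (hhalf q _ _ _ (by simp only [midpoint_eq_smul_add, invOf_eq_inv]; module) hxz)
      have e₂ := ih _ hxy_mem _ hxz_mem _ hyz_mem
        (hhalf q _ _ _ (by simp only [midpoint_eq_smul_add, invOf_eq_inv]; module) hyz)
        (hhalf q _ _ _ (by simp only [midpoint_eq_smul_add, invOf_eq_inv]; module) hxy)
        (hhalf q _ _ _ (by simp only [midpoint_eq_smul_add, invOf_eq_inv]; module) hxz)
      have e₃ := ih _ hx _ hxy_mem _ hxz_mem
        (hhalf q _ _ _ (by simp only [midpoint_eq_smul_add, invOf_eq_inv]; module) hxy)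
        (hhalf q _ _ _ (by simp only [midpoint_eq_smul_add, invOf_eq_inv]; module) hyz)
        (hhalf q _ _ _ (by simp only [midpoint_eq_smul_add, invOf_eq_inv]; module) hxz)
      have e₄ := ih _ hxz_mem _ hyz_mem _ hz
        (hhalf q _ _ _ (by simp only [midpoint_eq_smul_add, invOf_eq_inv]; module) hxy)
        (hhalf q _ _ _ (by simp only [midpoint_eq_smul_add, invOf_eq_inv]; module) hyz)
        (hhalf q _ _ _ (by simp only [midpoint_eq_smul_add, invOf_eq_inv]; module) hxz)
      rw [← hπ_mid S hS x hx y hy, ← hπ_mid S hS y hy z hz, ← hπ_mid S hS x hx z hz, ← e₃, ← e₄]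
      calc _ = π x (midpoint ℝ x y) * (π (midpoint ℝ x y) y * π y (midpoint ℝ y z)) *
            π (midpoint ℝ y z) z := by group
        _ = _ := by rw [e₁, ← e₂]; group
  intro x hx y hy z hz
  obtain ⟨M, hM⟩ := pow_unbounded_of_one_lt ((q (x - y) + q (y - z) + q (x - z)) / δ)
    (one_lt_two (α := ℝ))
  have hM := (div_lt_iff₀ hδ).1 hM
  have h₁ := apply_nonneg q (x - y)
  have h₂ := apply_nonneg q (y - z)
  have h₃ := apply_nonneg q (x - z)
  exact key M x hx y hy z hz (by linarith) (by linarith) (by linarith)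

end AffineChain

namespace CrossedModule

variable {C : Type v} {P : Type w} [Group C] [Group P] [MulDistribMulAction P C]

theorem mul_comm_of_bd_eq_one (𝒞 : CrossedModule C P) {a : C} (ha : 𝒞.bd a = 1) (c : C) :
    a * c = c * a := by
  have := 𝒞.peiffer a c
  rw [ha, one_smul] at this
  rw [eq_comm, ← eq_mul_inv_iff_mul_eq]
  exact this

/-- The kernel of `∂`, written additively. It is a `P`-module, on which `∂ C` acts trivially. -/
def Kernel (𝒞 : CrossedModule C P) : Type v := Additive 𝒞.bd.ker

namespace Kernel

variable {𝒞 : CrossedModule C P}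

instance : AddGroup 𝒞.Kernel := inferInstanceAs (AddGroup (Additive 𝒞.bd.ker))

instance : AddCommGroup 𝒞.Kernel :=
  { (inferInstance : AddGroup 𝒞.Kernel) with
    add_comm := fun a _ => Subtype.ext (𝒞.mul_comm_of_bd_eq_one (Additive.toMul a).2 _) }

/-- The element of `C` given by an element of the kernel. -/
def val (a : 𝒞.Kernel) : C := (Additive.toMul a).1

/-- The element of the kernel given by an element of `C`. -/
def mk (c : C) (hc : 𝒞.bd c = 1) : 𝒞.Kernel := Additive.ofMul ⟨c, hc⟩

@[simp] theorem val_mk (c : C) (hc : 𝒞.bd c = 1) : (mk c hc : 𝒞.Kernel).val = c := rfl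

theorem bd_val (a : 𝒞.Kernel) : 𝒞.bd a.val = 1 := (Additive.toMul a).2

theorem val_mul_comm (a : 𝒞.Kernel) (c : C) : a.val * c = c * a.val :=
  𝒞.mul_comm_of_bd_eq_one a.bd_val c

theorem val_injective : Function.Injective (val : 𝒞.Kernel → C) :=
  fun _ _ h => Subtype.ext h

@[simp] theorem val_zero : (0 : 𝒞.Kernel).val = 1 := rfl

@[simp] theorem val_add (a b : 𝒞.Kernel) : (a + b).val = a.val * b.val := rfl

instance : SMul P 𝒞.Kernel :=
  ⟨fun p a => mk (p • a.val) (by rw [𝒞.bd_smul, a.bd_val]; group)⟩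

@[simp] theorem val_smul (p : P) (a : 𝒞.Kernel) : (p • a).val = p • a.val := rfl

instance : DistribMulAction P 𝒞.Kernel where
  one_smul a := val_injective (by simp)
  mul_smul p q a := val_injective (by simp [mul_smul])
  smul_zero p := val_injective (by simp)
  smul_add p a b := val_injective (by simp)

theorem bd_smul (c : C) (a : 𝒞.Kernel) : 𝒞.bd c • a = a := by
  apply val_injective
  rw [val_smul, 𝒞.peiffer, ← val_mul_comm, mul_inv_cancel_right]

end Kernel

instance (𝒞 : CrossedModule C P) : 𝒞.bd.range.Normal where
  conj_mem := by
    rintro _ ⟨c, rfl⟩ p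
    exact ⟨p • c, 𝒞.bd_smul p c⟩

variable {𝒞 : CrossedModule C P} {X : Type*}

/-- If labels satisfy the boundary condition, then the failure `k` of the cocycle condition is
itself a cocycle: both ways of composing the labels of a `4`-simplex agree. -/
theorem defect_cocycle {p : X → X → P} {c : X → X → X → C} {k : X → X → X → X → 𝒞.Kernel}
    {x₀ x₁ x₂ x₃ x₄ : X}
    (hbd : 𝒞.bd (c x₀ x₁ x₂) = p x₀ x₂ * (p x₁ x₂)⁻¹ * (p x₀ x₁)⁻¹)
    (h₀ : c x₁ x₂ x₄ * p x₁ x₂ • c x₂ x₃ x₄ = (k x₁ x₂ x₃ x₄).val * (c x₁ x₃ x₄ * c x₁ x₂ x₃))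
    (h₁ : c x₀ x₂ x₄ * p x₀ x₂ • c x₂ x₃ x₄ = (k x₀ x₂ x₃ x₄).val * (c x₀ x₃ x₄ * c x₀ x₂ x₃))
    (h₂ : c x₀ x₁ x₄ * p x₀ x₁ • c x₁ x₃ x₄ = (k x₀ x₁ x₃ x₄).val * (c x₀ x₃ x₄ * c x₀ x₁ x₃))
    (h₃ : c x₀ x₁ x₄ * p x₀ x₁ • c x₁ x₂ x₄ = (k x₀ x₁ x₂ x₄).val * (c x₀ x₂ x₄ * c x₀ x₁ x₂))
    (h₄ : c x₀ x₁ x₃ * p x₀ x₁ • c x₁ x₂ x₃ = (k x₀ x₁ x₂ x₃).val * (c x₀ x₂ x₃ * c x₀ x₁ x₂)) :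
    p x₀ x₁ • k x₁ x₂ x₃ x₄ - k x₀ x₂ x₃ x₄ + k x₀ x₁ x₃ x₄ - k x₀ x₁ x₂ x₄ +
      k x₀ x₁ x₂ x₃ = 0 := by
  have e₁ : c x₀ x₁ x₄ * p x₀ x₁ • (c x₁ x₂ x₄ * p x₁ x₂ • c x₂ x₃ x₄) =
      (p x₀ x₁ • k x₁ x₂ x₃ x₄ + k x₀ x₁ x₃ x₄ + k x₀ x₁ x₂ x₃).val *
        (c x₀ x₃ x₄ * c x₀ x₂ x₃ * c x₀ x₁ x₂) := by
    rw [h₀, smul_mul', smul_mul', ← Kernel.val_smul, ← mul_assoc, ← Kernel.val_mul_comm,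
      mul_assoc, ← mul_assoc (c x₀ x₁ x₄), h₂]
    simp only [Kernel.val_add, mul_assoc]
    rw [h₄, ← mul_assoc (c x₀ x₃ x₄), ← Kernel.val_mul_comm]
    simp only [mul_assoc]
  have hp : p x₀ x₁ * p x₁ x₂ = 𝒞.bd (c x₀ x₁ x₂)⁻¹ * p x₀ x₂ := by
    rw [map_inv, hbd]; group
  have e₂ : c x₀ x₁ x₄ * p x₀ x₁ • (c x₁ x₂ x₄ * p x₁ x₂ • c x₂ x₃ x₄) =
      (k x₀ x₁ x₂ x₄ + k x₀ x₂ x₃ x₄).val * (c x₀ x₃ x₄ * c x₀ x₂ x₃ * c x₀ x₁ x₂) := by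
    rw [smul_mul', smul_smul, hp, mul_smul, 𝒞.peiffer, ← mul_assoc, h₃, inv_inv]
    calc _ = (k x₀ x₁ x₂ x₄).val * (c x₀ x₂ x₄ * p x₀ x₂ • c x₂ x₃ x₄) * c x₀ x₁ x₂ := by group
      _ = _ := by rw [h₁, Kernel.val_add]; simp only [mul_assoc]
  have := Kernel.val_injective (mul_right_cancel (e₁.symm.trans e₂))
  rw [← sub_eq_zero] at this
  rw [← this]
  abel

variable {E : Type*} [AddCommGroup E] [Module ℝ E]

open AffineChain

/-- A cocycle on `𝓨` extends to `𝓩`. The labels of edges modulo `∂ C` form a functor, which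
extends; the obstruction to extending the labels of triangles is a class in the third cohomology
of `𝓩` relative to `𝓨`, which vanishes. -/
theorem IsCocycleOn.exists_extension {𝓨 𝓩 : Set (Set E)} {p : E → E → P} {c : E → E → E → C}
    (hc : 𝒞.IsCocycleOn 𝓨 p c) (h : IsFineIn 𝓨 𝓩) :
    ∃ (p' : E → E → P) (c' : E → E → E → C), 𝒞.IsCocycleOn 𝓩 p' c' ∧
      (∀ U ∈ 𝓨, ∀ x ∈ U, ∀ y ∈ U, p' x y = p x y) ∧
      ∀ U ∈ 𝓨, ∀ x ∈ U, ∀ y ∈ U, ∀ z ∈ U, c' x y z = c x y z := by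
  classical
  obtain ⟨π, hπ, hπ₀⟩ := h.exists_functor
    (fun x y => (QuotientGroup.mk (p x y) : P ⧸ 𝒞.bd.range)) (by
      intro U hU x hx y hy z hz
      rw [← QuotientGroup.mk_mul, eq_comm, QuotientGroup.eq]
      refine (Subgroup.Normal.mem_comm_iff inferInstance).1 ⟨(c x y z)⁻¹, ?_⟩
      rw [map_inv, hc.boundary U hU x hx y hy z hz]
      group)
  let p' : E → E → P := fun x y => if ∃ U ∈ 𝓨, x ∈ U ∧ y ∈ U then p x y else (π x y).out
  have hp' : ∀ U ∈ 𝓨, ∀ x ∈ U, ∀ y ∈ U, p' x y = p x y := fun U hU x hx y hy =>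
    if_pos ⟨U, hU, hx, hy⟩
  have hp'π : ∀ x y, (QuotientGroup.mk (p' x y) : P ⧸ 𝒞.bd.range) = π x y := by
    intro x y
    by_cases hxy : ∃ U ∈ 𝓨, x ∈ U ∧ y ∈ U
    · obtain ⟨U, hU, hx, hy⟩ := hxy
      rw [hp' U hU x hx y hy, hπ₀ U hU x hx y hy]
    · simp only [p', if_neg hxy]
      exact QuotientGroup.out_eq' _
  have hex : ∀ S ∈ 𝓩, ∀ x ∈ S, ∀ y ∈ S, ∀ z ∈ S,
      ∃ a, 𝒞.bd a = p' x z * (p' y z)⁻¹ * (p' x y)⁻¹ := by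
    intro S hS x hx y hy z hz
    have := hπ S hS x hx y hy z hz
    rw [← hp'π, ← hp'π, ← hp'π, ← QuotientGroup.mk_mul, QuotientGroup.eq] at this
    obtain ⟨a, ha⟩ := (Subgroup.Normal.mem_comm_iff inferInstance).1 this
    exact ⟨a, by rw [ha]; group⟩
  let c₀ : E → E → E → C := fun x y z =>
    if ∃ U ∈ 𝓨, x ∈ U ∧ y ∈ U ∧ z ∈ U then c x y z else
      if h : ∃ a, 𝒞.bd a = p' x z * (p' y z)⁻¹ * (p' x y)⁻¹ then h.choose else 1
  have hc₀ : ∀ U ∈ 𝓨, ∀ x ∈ U, ∀ y ∈ U, ∀ z ∈ U, c₀ x y z = c x y z :=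
    fun U hU x hx y hy z hz => if_pos ⟨U, hU, hx, hy, hz⟩
  have hbd : ∀ S ∈ 𝓩, ∀ x ∈ S, ∀ y ∈ S, ∀ z ∈ S,
      𝒞.bd (c₀ x y z) = p' x z * (p' y z)⁻¹ * (p' x y)⁻¹ := by
    intro S hS x hx y hy z hz
    by_cases hxyz : ∃ U ∈ 𝓨, x ∈ U ∧ y ∈ U ∧ z ∈ U
    · obtain ⟨U, hU, hx, hy, hz⟩ := hxyz
      rw [hc₀ U hU x hx y hy z hz, hp' U hU x hx z hz, hp' U hU y hy z hz, hp' U hU x hx y hy,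
        hc.boundary U hU x hx y hy z hz]
    · have hxyz' := hex S hS x hx y hy z hz
      simp only [c₀, if_neg hxyz, dif_pos hxyz']
      exact hxyz'.choose_spec
  let D : E → E → E → E → C := fun x y z t =>
    c₀ x y t * p' x y • c₀ y z t * (c₀ x z t * c₀ x y z)⁻¹
  let k : E → E → E → E → 𝒞.Kernel := fun x y z t =>
    if h : 𝒞.bd (D x y z t) = 1 then Kernel.mk _ h else 0
  have hk : ∀ S ∈ 𝓩, ∀ x ∈ S, ∀ y ∈ S, ∀ z ∈ S, ∀ t ∈ S,
      c₀ x y t * p' x y • c₀ y z t = (k x y z t).val * (c₀ x z t * c₀ x y z) := by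
    intro S hS x hx y hy z hz t ht
    have : 𝒞.bd (D x y z t) = 1 := by
      simp only [D, map_mul, map_inv, 𝒞.bd_smul, hbd S hS x hx y hy t ht,
        hbd S hS y hy z hz t ht, hbd S hS x hx z hz t ht, hbd S hS x hx y hy z hz]
      group
    simp only [k, dif_pos this, Kernel.val_mk, D]
    group
  have hk₀ : ∀ U ∈ 𝓨, ∀ x ∈ U, ∀ y ∈ U, ∀ z ∈ U, ∀ t ∈ U, k x y z t = 0 := by
    intro U hU x hx y hy z hz t ht
    have hD : D x y z t = 1 := by
      simp only [D, hc₀ U hU x hx y hy t ht, hc₀ U hU y hy z hz t ht, hc₀ U hU x hx z hz t ht,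
        hc₀ U hU x hx y hy z hz, hp' U hU x hx y hy, hc.cocycle U hU x hx y hy z hz t ht]
      group
    apply Kernel.val_injective
    simp [k, hD]
  have hself : ∀ S ∈ 𝓩, ∀ x ∈ S, p' x x = 1 := by
    intro S hS x hx
    obtain ⟨q, δ, hδ, hball⟩ := h.exists_ball S hS
    have hx' : x ∈ S ∩ q.ball x δ := ⟨hx, by simpa [Seminorm.mem_ball] using hδ⟩
    rw [hp' _ (hball x hx) x hx' x hx', hc.p_self _ (hball x hx) x hx']
  obtain ⟨a, ha, ha₀⟩ := h.exists_primitive p' k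
    (fun S hS x hx a => by rw [hself S hS x hx, one_smul])
    (fun S hS x hx y hy z hz a => by
      have : p' x y * p' y z = 𝒞.bd (c₀ x y z)⁻¹ * p' x z := by
        rw [map_inv, hbd S hS x hx y hy z hz]; group
      rw [smul_smul, this, mul_smul, Kernel.bd_smul])
    (fun S hS x hx y hy z hz t ht r hr => defect_cocycle (hbd S hS x hx y hy z hz)
      (hk S hS y hy z hz t ht r hr) (hk S hS x hx z hz t ht r hr) (hk S hS x hx y hy t ht r hr)
      (hk S hS x hx y hy z hz r hr) (hk S hS x hx y hy z hz t ht)) hk₀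
  refine ⟨p', fun x y z => (-a x y z).val * c₀ x y z, ⟨hself, ?_, ?_⟩, hp', ?_⟩
  · intro S hS x hx y hy z hz
    rw [map_mul, Kernel.bd_val, one_mul, hbd S hS x hx y hy z hz]
  · intro S hS x hx y hy z hz t ht
    have e₁ : (-a x y t).val * c₀ x y t * p' x y • ((-a y z t).val * c₀ y z t) =
        (-a x y t + p' x y • -a y z t).val * (c₀ x y t * p' x y • c₀ y z t) := by
      rw [smul_mul', ← Kernel.val_smul, Kernel.val_add, mul_assoc, ← mul_assoc (c₀ x y t),
        ← Kernel.val_mul_comm]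
      simp only [mul_assoc]
    have e₂ : (-a x z t).val * c₀ x z t * ((-a x y z).val * c₀ x y z) =
        (-a x z t + -a x y z).val * (c₀ x z t * c₀ x y z) := by
      rw [Kernel.val_add, mul_assoc, ← mul_assoc (c₀ x z t), ← Kernel.val_mul_comm]
      simp only [mul_assoc]
    rw [e₁, e₂, hk S hS x hx y hy z hz t ht, ← mul_assoc, ← Kernel.val_add,
      ← ha S hS x hx y hy z hz t ht, smul_neg]
    congr 2
    abel
  · intro U hU x hx y hy z hz
    simp [ha₀ U hU x hx y hy z hz, hc₀ U hU x hx y hy z hz]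

end CrossedModule

/-! ### The weak topology on the geometric realisation -/

namespace AbstractSimplicialComplex.Realization

open scoped Topology

variable {V : Type u} {K : AbstractSimplicialComplex V}

/-- The sum of the coordinates of a vector. -/
noncomputable def mass : (V →₀ ℝ) →ₗ[ℝ] ℝ := Finsupp.linearCombination ℝ fun _ => (1 : ℝ)

theorem mass_apply (x : V →₀ ℝ) : mass x = x.sum fun _ a => a := by
  simp [mass, Finsupp.linearCombination_apply]

theorem mass_eq_sum {x : V →₀ ℝ} {s : Finset V} (hs : x.support ⊆ s) :
    mass x = ∑ v ∈ s, x v := by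
  rw [mass_apply]
  exact Finsupp.sum_of_support_subset _ hs _ fun _ _ => rfl

theorem mass_weight (x : Realization K) : mass x.weight = 1 := by
  rw [mass_apply, x.sum_eq_one]

theorem mass_nonneg {x : V →₀ ℝ} (hx : ∀ v, 0 ≤ x v) : 0 ≤ mass x := by
  rw [mass_eq_sum (Finset.Subset.refl _)]
  exact Finset.sum_nonneg fun v _ => hx v

theorem eq_zero_of_mass_eq_zero {x : V →₀ ℝ} (hx : ∀ v, 0 ≤ x v) (h : mass x = 0) : x = 0 := by
  rw [mass_eq_sum (Finset.Subset.refl _), Finset.sum_eq_zero_iff_of_nonneg fun v _ => hx v] at h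
  ext v
  by_cases hv : v ∈ x.support
  · exact h v hv
  · simpa using hv

/-- The topology of barycentric coordinates on a closed simplex. -/
abbrev simplexTopology (K : AbstractSimplicialComplex V) (s : Finset V) :
    TopologicalSpace (closedSimplex K s) :=
  TopologicalSpace.induced (fun x (v : V) => x.1.weight v) inferInstance

theorem isOpen_iff {U : Set (Realization K)} : IsOpen U ↔ ∀ s ∈ K.faces,
    IsOpen[simplexTopology K s] (Subtype.val ⁻¹' U : Set (closedSimplex K s)) :=
  isOpen_iSup_iff.trans ⟨fun h s hs => h ⟨s, hs⟩, fun h s => h s.1 s.2⟩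

theorem continuous_val_simplexTopology {s : Finset V} (hs : s ∈ K.faces) :
    Continuous[simplexTopology K s, _] (Subtype.val : closedSimplex K s → Realization K) :=
  continuous_def.2 fun _ hU => isOpen_iff.1 hU s hs

theorem continuous_simplexTopology_weight (s : Finset V) (v : V) :
    Continuous[simplexTopology K s, _] fun x : closedSimplex K s => x.1.weight v :=
  @Continuous.comp _ _ _ (simplexTopology K s) _ _ _ _ (continuous_apply v) continuous_induced_dom

theorem continuous_weight (v : V) : Continuous fun x : Realization K => x.weight v :=
  continuous_def.2 fun _ hU => isOpen_iff.2 fun s _ =>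
    continuous_def.1 (continuous_simplexTopology_weight s v) _ hU

/-- A map into a single closed simplex is continuous if its barycentric coordinates are. -/
theorem continuous_of_closedSimplex {Z : Type*} [TopologicalSpace Z] {s : Finset V}
    (hs : s ∈ K.faces) {f : Z → Realization K} (hfs : ∀ z, f z ∈ closedSimplex K s)
    (hf : ∀ v, Continuous fun z => (f z).weight v) : Continuous f := by
  have h₁ : Continuous[_, simplexTopology K s] fun z => (⟨f z, hfs z⟩ : closedSimplex K s) :=
    continuous_induced_rng.2 (continuous_pi hf)
  exact @Continuous.comp _ _ _ _ (simplexTopology K s) _ _ _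
    (continuous_val_simplexTopology hs) h₁

instance : T2Space (Realization K) := by
  refine T2Space.of_injective_continuous (f := fun x : Realization K => (x.weight : V → ℝ)) ?_
    (continuous_pi continuous_weight)
  intro x y h
  exact Realization.ext (DFunLike.coe_injective h)

theorem support_nonempty (x : Realization K) : x.weight.support.Nonempty :=
  (K.isRelLowerSet_faces x.support_mem).1

open Classical in
/-- The parametrisation of a closed simplex by the standard simplex. -/
noncomputable def ofStdSimplex {s : Finset V} (hs : s ∈ K.faces) (a : stdSimplex ℝ s) :
    Realization K where
  weight := Finsupp.onFinset s (fun v => if h : v ∈ s then a.1 ⟨v, h⟩ else 0) fun v hv => by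
    by_contra h
    simp [h] at hv
  nonneg v := by
    rw [Finsupp.onFinset_apply]
    split_ifs
    · exact a.2.1 _
    · rfl
  sum_eq_one := by
    rw [Finsupp.onFinset_sum _ (by simp), ← a.2.2, ← Finset.sum_coe_sort]
    simp
  support_mem := by
    refine mem_faces_of_subset hs Finsupp.support_onFinset_subset ?_
    rw [Finset.nonempty_iff_ne_empty, Ne, Finsupp.support_eq_empty]
    intro h
    have h₁ := a.2.2
    have : ∀ i, a.1 i = 0 := fun i => by
      have := DFunLike.congr_fun h i.1
      simpa using this
    simp [this] at h₁

theorem ofStdSimplex_weight {s : Finset V} (hs : s ∈ K.faces) (a : stdSimplex ℝ s) (v : s) :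
    (ofStdSimplex hs a).weight v = a.1 v := by
  simp [ofStdSimplex]

theorem ofStdSimplex_mem {s : Finset V} (hs : s ∈ K.faces) (a : stdSimplex ℝ s) :
    ofStdSimplex hs a ∈ closedSimplex K s := by
  intro v hv
  by_contra h
  exact Finsupp.mem_support_iff.1 hv (by simpa [ofStdSimplex] using fun h' => absurd h' h)

theorem weight_eq_zero {s : Finset V} {x : Realization K} (hx : x ∈ closedSimplex K s) {v : V}
    (hv : v ∉ s) : x.weight v = 0 := by
  by_contra h
  exact hv (hx (Finsupp.mem_support_iff.2 h))

/-- The coordinates of a point of a closed simplex, as a point of the standard simplex. -/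
noncomputable def toStdSimplex (s : Finset V) (x : closedSimplex K s) : stdSimplex ℝ s :=
  ⟨fun v => x.1.weight v, fun v => x.1.nonneg v, by
    rw [Finset.sum_coe_sort s (fun v => x.1.weight v), ← mass_eq_sum x.2, mass_weight]⟩

theorem ofStdSimplex_toStdSimplex {s : Finset V} (hs : s ∈ K.faces) (x : closedSimplex K s) :
    ofStdSimplex hs (toStdSimplex s x) = x.1 := by
  ext v
  by_cases hv : v ∈ s
  · exact ofStdSimplex_weight hs _ ⟨v, hv⟩
  · rw [weight_eq_zero (ofStdSimplex_mem hs _) hv, weight_eq_zero x.2 hv]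

theorem continuous_ofStdSimplex {s : Finset V} (hs : s ∈ K.faces) :
    Continuous (ofStdSimplex hs) := by
  refine continuous_of_closedSimplex hs (ofStdSimplex_mem hs) fun v => ?_
  by_cases hv : v ∈ s
  · have : (fun a => (ofStdSimplex hs a).weight v) = fun a : stdSimplex ℝ s => a.1 ⟨v, hv⟩ :=
      funext fun a => ofStdSimplex_weight hs a ⟨v, hv⟩
    rw [this]
    exact (continuous_apply _).comp continuous_subtype_val
  · simp only [weight_eq_zero (ofStdSimplex_mem hs _) hv]
    exact continuous_const

theorem isCompact_closedSimplex {s : Finset V} (hs : s ∈ K.faces) :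
    IsCompact (closedSimplex K s) := by
  have : closedSimplex K s = Set.range (ofStdSimplex hs) := by
    ext x
    constructor
    · exact fun hx => ⟨_, ofStdSimplex_toStdSimplex hs ⟨x, hx⟩⟩
    · rintro ⟨a, rfl⟩
      exact ofStdSimplex_mem hs a
  rw [this]
  exact isCompact_range (continuous_ofStdSimplex hs)

theorem isCompact_setOf_support_subset (F : Finset V) :
    IsCompact {x : Realization K | x.weight.support ⊆ F} := by
  have : {x : Realization K | x.weight.support ⊆ F} =
      ⋃ s ∈ {s | s ∈ F.powerset ∧ s ∈ K.faces}, closedSimplex K s := by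
    ext x
    simp only [Set.mem_ofPred_eq, Set.mem_iUnion, exists_prop, Finset.mem_powerset, closedSimplex]
    exact ⟨fun h => ⟨_, ⟨h, x.support_mem⟩, subset_rfl⟩, fun ⟨s, hs, hx⟩ => hx.trans hs.1⟩
  rw [this]
  exact ((Finset.finite_toSet F.powerset).subset fun s hs => hs.1).isCompact_biUnion
    fun s hs => isCompact_closedSimplex hs.2

/-- A subset of the realisation is closed if on each closed simplex it agrees with a closed set. -/
theorem isClosed_of_closedSimplex {A : Set (Realization K)}
    (h : ∀ s ∈ K.faces, ∃ B, IsClosed B ∧ ∀ x ∈ closedSimplex K s, x ∈ A ↔ x ∈ B) :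
    IsClosed A := by
  rw [← isOpen_compl_iff, isOpen_iff]
  intro s hs
  obtain ⟨B, hB, hAB⟩ := h s hs
  have : (Subtype.val ⁻¹' Aᶜ : Set (closedSimplex K s)) = Subtype.val ⁻¹' Bᶜ := by
    ext x
    exact not_congr (hAB x.1 x.2)
  rw [this]
  exact isOpen_iff.1 hB.isOpen_compl s hs

/-- The realisation is a quotient of the disjoint union of its closed simplices. -/
theorem isQuotientMap_ofStdSimplex : Topology.IsQuotientMap
    (fun x : Σ s : {s : Finset V // s ∈ K.faces}, stdSimplex ℝ s.1 => ofStdSimplex x.1.2 x.2) := by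
  rw [Topology.isQuotientMap_iff]
  refine ⟨.of_isOpen_preimage_iff_isOpen fun U => ⟨fun hU => ?_, fun hU => hU.preimage ?_⟩,
    fun x => ⟨⟨⟨x.weight.support, x.support_mem⟩, toStdSimplex _ ⟨x, Finset.Subset.refl _⟩⟩,
      ofStdSimplex_toStdSimplex x.support_mem _⟩⟩
  · refine isOpen_iff.2 fun s hs => ?_
    have hcont : Continuous[simplexTopology K s, _] (toStdSimplex s : closedSimplex K s → _) :=
      continuous_induced_rng.2 (@continuous_pi _ _ _ (simplexTopology K s) _ _
        fun v => continuous_simplexTopology_weight s v.1)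
    have : (Subtype.val ⁻¹' U : Set (closedSimplex K s)) =
        toStdSimplex s ⁻¹' (ofStdSimplex hs ⁻¹' U) := by
      ext x
      simp only [Set.mem_preimage, ofStdSimplex_toStdSimplex]
    rw [this]
    exact continuous_def.1 hcont _
      (hU.preimage (continuous_sigmaMk (σ := fun s : {s : Finset V // s ∈ K.faces} =>
        stdSimplex ℝ s.1) (i := ⟨s, hs⟩)))
  · exact continuous_sigma fun s => continuous_ofStdSimplex s.2

/-- Every set of vertices is closed in the realisation. -/
theorem isClosed_image_vertex (A : Set V) : IsClosed (vertex K '' A) := by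
  refine isClosed_of_closedSimplex fun s _ => ⟨vertex K '' (A ∩ s), ?_, fun x hx => ?_⟩
  · exact ((s.finite_toSet.inter_of_right A).image _).isClosed
  · constructor
    · rintro ⟨v, hv, rfl⟩
      refine ⟨v, ⟨hv, hx ?_⟩, rfl⟩
      simp [vertex]
    · rintro ⟨v, hv, rfl⟩
      exact ⟨v, hv.1, rfl⟩

theorem vertex_injective : Function.Injective (vertex K) := by
  intro u v h
  have := congrArg Realization.weight h
  exact (Finsupp.single_left_inj one_ne_zero).1 this

/-- A compact subset of the realisation contains finitely many vertices only. -/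
theorem finite_setOf_vertex_mem {C : Set (Realization K)} (hC : IsCompact C) :
    {v | vertex K v ∈ C}.Finite := by
  refine Set.Finite.of_finite_image (f := vertex K) ?_ vertex_injective.injOn
  refine (hC.of_isClosed_subset (isClosed_image_vertex _) ?_).finite ?_
  · rintro _ ⟨v, hv, rfl⟩
    exact hv
  · rw [isDiscrete_iff_forall_mem_exists_isClosed]
    refine fun A hA => ⟨A, ?_, Set.inter_eq_left.2 hA⟩
    obtain ⟨B, -, rfl⟩ := Set.subset_image_iff.1 hA
    exact isClosed_image_vertex B

/-- A continuous bijection `|T| → |K| × I` is a homeomorphism if the preimage of the product of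
`I` with a closed simplex of `K` meets finitely many simplices of `T` only. -/
theorem continuous_symm_of_finite {W : Type*} {T : AbstractSimplicialComplex W}
    (H : Realization T ≃ Realization K × unitInterval) (hH : Continuous H)
    (hfin : ∀ s ∈ K.faces, ∃ F : Finset W, ∀ y, (H y).1 ∈ closedSimplex K s →
      y.weight.support ⊆ F) : Continuous H.symm := by
  refine isQuotientMap_ofStdSimplex.continuous_lift_prod_left (continuous_iff_continuousAt.2 ?_)
  rintro ⟨⟨s, a⟩, r⟩
  have hemb : Topology.IsOpenEmbedding (Prod.map (Sigma.mk
      (β := fun s : {s : Finset V // s ∈ K.faces} => stdSimplex ℝ s.1) s) (id : unitInterval → unitInterval)) :=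
    Topology.IsOpenEmbedding.sigmaMk.prodMap .id
  refine (hemb.continuousAt_iff (x := (a, r))).1 (Continuous.continuousAt ?_)
  obtain ⟨F, hF⟩ := hfin s.1 s.2
  refine continuous_iff_isClosed.2 fun A hA => ?_
  have hcomp : IsCompact (H '' (A ∩ {y | y.weight.support ⊆ F})) :=
    ((isCompact_setOf_support_subset F).inter_left hA).image hH
  have hcont : Continuous fun z : stdSimplex ℝ s.1 × unitInterval => (ofStdSimplex s.2 z.1, z.2) :=
    ((continuous_ofStdSimplex s.2).comp continuous_fst).prodMk continuous_snd
  convert hcomp.isClosed.preimage hcont using 1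
  ext z
  simp only [Set.mem_preimage, Function.comp, Prod.map, id]
  constructor
  · intro hz
    refine ⟨_, ⟨hz, hF _ ?_⟩, H.apply_symm_apply _⟩
    rw [H.apply_symm_apply]
    exact ofStdSimplex_mem s.2 z.1
  · rintro ⟨y, ⟨hy, -⟩, hyz⟩
    rw [← hyz, H.symm_apply_apply]
    exact hy

end AbstractSimplicialComplex.Realization

/-! ### A triangulation of the cylinder -/

namespace AbstractSimplicialComplex

namespace Realization

variable {V : Type u} {K : AbstractSimplicialComplex V}

/-- A non-negative vector can be split into a vector of given mass `m` on its lower coordinates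
and one on its upper coordinates. At most one coordinate is divided between them. -/
theorem exists_split [LinearOrder V] (y : V →₀ ℝ) (hy : ∀ v, 0 ≤ y v) {m : ℝ} (hm : 0 ≤ m)
    (hmy : m ≤ mass y) : ∃ a b : V →₀ ℝ, a + b = y ∧ (∀ v, 0 ≤ a v) ∧ (∀ v, 0 ≤ b v) ∧
      mass a = m ∧ ∀ u ∈ a.support, ∀ w ∈ b.support, u ≤ w := by
  induction y using Finsupp.induction_on_max generalizing m with
  | zero =>
    refine ⟨0, 0, by simp, by simp, by simp, ?_, by simp⟩
    rw [map_zero] at hmy ⊢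
    exact le_antisymm hm hmy
  | single_add x r f hlt hr ih =>
    have hfx : f x = 0 := by
      by_contra h
      exact lt_irrefl x (hlt x (Finsupp.mem_support_iff.2 h))
    have hr₀ : 0 ≤ r := by simpa [hfx] using hy x
    have hf : ∀ v, 0 ≤ f v := by
      intro v
      by_cases hv : v = x
      · rw [hv, hfx]
      · simpa [Finsupp.single_apply, Ne.symm hv] using hy v
    have hmass : mass (Finsupp.single x r) = r := by simp [mass]
    rw [map_add, hmass] at hmy
    rcases le_total m (mass f) with h | h
    · obtain ⟨a, b, hab, ha, hb, hma, hle⟩ := ih hf hm h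
      refine ⟨a, Finsupp.single x r + b, by rw [← hab]; abel, ha, fun v => ?_, hma, ?_⟩
      · rw [Finsupp.add_apply]
        refine add_nonneg ?_ (hb v)
        rw [Finsupp.single_apply]
        split_ifs
        · exact hr₀
        · rfl
      · intro u hu w hw
        by_cases hwb : w ∈ b.support
        · exact hle u hu w hwb
        · have hwx : w = x := by
            by_contra hwx
            apply Finsupp.mem_support_iff.1 hw
            rw [Finsupp.add_apply, Finsupp.notMem_support_iff.1 hwb, Finsupp.single_apply,
              if_neg (Ne.symm hwx), add_zero]
          rw [hwx]
          refine (hlt u (Finsupp.mem_support_iff.2 ?_)).le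
          rw [← hab, Finsupp.add_apply]
          have h₁ := lt_of_le_of_ne (ha u) (Ne.symm (Finsupp.mem_support_iff.1 hu))
          have := hb u
          positivity
    · refine ⟨f + Finsupp.single x (m - mass f), Finsupp.single x (r - (m - mass f)), ?_, ?_, ?_,
        ?_, ?_⟩
      · rw [add_assoc, ← Finsupp.single_add, add_comm f]
        congr 2
        ring
      · intro v
        rw [Finsupp.add_apply]
        refine add_nonneg (hf v) ?_
        rw [Finsupp.single_apply]
        split_ifs
        · linarith
        · rfl
      · intro v
        rw [Finsupp.single_apply]
        split_ifs
        · linarith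
        · rfl
      · rw [map_add]
        simp [mass]
      · intro u hu w hw
        have hwx : w = x := by
          by_contra hwx
          exact Finsupp.mem_support_iff.1 hw (by rw [Finsupp.single_apply, if_neg (Ne.symm hwx)])
        rw [hwx]
        by_cases huf : u ∈ f.support
        · exact (hlt u huf).le
        · refine le_of_eq ?_
          by_contra hux
          apply Finsupp.mem_support_iff.1 hu
          rw [Finsupp.add_apply, Finsupp.notMem_support_iff.1 huf, Finsupp.single_apply,
            if_neg (Ne.symm hux), add_zero]

/-- The splitting of a vector into a lower and an upper part is determined by their masses. -/
theorem split_unique [LinearOrder V] {a b a' b' : V →₀ ℝ} (hab : a + b = a' + b')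
    (ha : ∀ v, 0 ≤ a v) (hb : ∀ v, 0 ≤ b v) (ha' : ∀ v, 0 ≤ a' v) (hb' : ∀ v, 0 ≤ b' v)
    (hm : mass a = mass a') (hle : ∀ u ∈ a.support, ∀ w ∈ b.support, u ≤ w)
    (hle' : ∀ u ∈ a'.support, ∀ w ∈ b'.support, u ≤ w) : a = a' := by
  have hsum : ∀ v, a v + b v = a' v + b' v := fun v => DFunLike.congr_fun hab v
  -- a coordinate where `a` exceeds `a'` would be both above and below one where `a'` exceeds `a`
  have key : ∀ u w, a' u < a u → a w < a' w → False := by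
    intro u w hu hw
    have h₁ : u ≤ w := hle u (Finsupp.mem_support_iff.2 (by have := ha' u; linarith))
      w (Finsupp.mem_support_iff.2 (by have := hb' w; have := hsum w; linarith))
    have h₂ : w ≤ u := hle' w (Finsupp.mem_support_iff.2 (by have := ha w; linarith))
      u (Finsupp.mem_support_iff.2 (by have := hb u; have := hsum u; linarith))
    obtain rfl := le_antisymm h₁ h₂
    exact lt_asymm hu hw
  have hzero : ∀ c d : V →₀ ℝ, mass c = mass d → (∀ v, c v ≤ d v) → c = d := by
    intro c d hcd h
    have := eq_zero_of_mass_eq_zero (x := d - c) (fun v => by simpa using h v)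
      (by rw [map_sub, hcd, sub_self])
    exact (sub_eq_zero.1 this).symm
  by_cases h : ∀ v, a v ≤ a' v
  · exact hzero a a' hm h
  · push Not at h
    obtain ⟨u, hu⟩ := h
    exact (hzero a' a hm.symm fun w => not_lt.1 fun hw => key u w hu hw).symm

theorem eq_vertex {x : Realization K} {v : V} (h : x.weight.support ⊆ {v}) : x = vertex K v := by
  have h₁ := mass_weight x
  rw [mass_eq_sum h, Finset.sum_singleton] at h₁
  ext w
  by_cases hw : w = v
  · subst hw
    simpa [vertex] using h₁
  · have : w ∉ x.weight.support := fun h' => hw (by simpa using h h')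
    rw [Finsupp.notMem_support_iff.1 this]
    simp [vertex, Ne.symm hw]

/-- The closed simplex on the vertex set `s`, as a convex set of weights. -/
def cell (s : Finset V) : Set (V →₀ ℝ) :=
  {x | (∀ v, 0 ≤ x v) ∧ mass x = 1 ∧ x.support ⊆ s}

theorem convex_cell (s : Finset V) : Convex ℝ (cell s) := by
  intro x hx y hy a b ha hb hab
  refine ⟨fun v => ?_, ?_, fun v hv => ?_⟩
  · have h₁ := hx.1 v
    have h₂ := hy.1 v
    simp only [Finsupp.add_apply, Finsupp.smul_apply, smul_eq_mul]
    positivity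
  · simp [hx.2.1, hy.2.1, hab]
  · by_contra hvs
    have h₁ : x v = 0 := by_contra fun h => hvs (hx.2.2 (Finsupp.mem_support_iff.2 h))
    have h₂ : y v = 0 := by_contra fun h => hvs (hy.2.2 (Finsupp.mem_support_iff.2 h))
    simp [h₁, h₂] at hv

theorem weight_mem_cell {x : Realization K} {s : Finset V} (h : x.weight.support ⊆ s) :
    x.weight ∈ cell s :=
  ⟨x.nonneg, mass_weight x, h⟩

theorem exists_weight_eq {s : Finset V} (hs : s ∈ K.faces) {y : V →₀ ℝ} (hy : y ∈ cell s) :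
    ∃ x : Realization K, x.weight = y ∧ x ∈ closedSimplex K s := by
  refine ⟨⟨y, hy.1, by rw [← mass_apply, hy.2.1], mem_faces_of_subset hs hy.2.2 ?_⟩, rfl, hy.2.2⟩
  rw [Finset.nonempty_iff_ne_empty, Ne, Finsupp.support_eq_empty]
  rintro rfl
  simpa using hy.2.1

end Realization

namespace Subdivision

variable {V V' : Type u} {K' : AbstractSimplicialComplex V'} {K : AbstractSimplicialComplex V}
  (S : Subdivision K' K)

/-- The linear extension of the map `V' → |K|` of vertices. -/
noncomputable def push : (V' →₀ ℝ) →ₗ[ℝ] (V →₀ ℝ) :=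
  Finsupp.linearCombination ℝ fun v => (S.homeo (vertex K' v)).weight

theorem push_apply {a : V' →₀ ℝ} {s : Finset V'} (hs : a.support ⊆ s) (w : V) :
    S.push a w = ∑ v ∈ s, a v * (S.homeo (vertex K' v)).weight w := by
  rw [push, Finsupp.linearCombination_apply, Finsupp.sum_of_support_subset _ hs _ (by simp),
    Finsupp.finsetSum_apply]
  simp

theorem homeo_weight (x : Realization K') : (S.homeo x).weight = S.push x.weight := by
  ext w
  rw [S.affine, S.push_apply subset_rfl]
  rfl

theorem push_single (v : V') : S.push (Finsupp.single v 1) = (S.homeo (vertex K' v)).weight := by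
  simp [push]

theorem mass_push (a : V' →₀ ℝ) : mass (S.push a) = mass a := by
  suffices mass ∘ₗ S.push = mass from DFunLike.congr_fun this a
  refine Finsupp.lhom_ext' fun v => LinearMap.ext_ring ?_
  change mass (S.push (Finsupp.single v 1)) = mass (Finsupp.single v 1)
  rw [push_single, mass_weight]
  simp [mass]

theorem push_nonneg {a : V' →₀ ℝ} (ha : ∀ v, 0 ≤ a v) (w : V) : 0 ≤ S.push a w := by
  rw [S.push_apply subset_rfl]
  exact Finset.sum_nonneg fun v _ => mul_nonneg (ha v) (Realization.nonneg _ w)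

/-- The vertex set of the smallest simplex of `K` that contains the vertex `v` of `K'`. -/
noncomputable def carrier (v : V') : Finset V := (S.homeo (vertex K' v)).weight.support

theorem carrier_nonempty (v : V') : (S.carrier v).Nonempty := support_nonempty _

theorem carrier_subset_support_push {a : V' →₀ ℝ} (ha : ∀ v, 0 ≤ a v) {v : V'}
    (hv : v ∈ a.support) : S.carrier v ⊆ (S.push a).support := by
  intro w hw
  rw [Finsupp.mem_support_iff, S.push_apply subset_rfl]
  refine (Finset.sum_pos' (fun u _ => mul_nonneg (ha u) (Realization.nonneg _ w))
    ⟨v, hv, mul_pos ?_ ?_⟩).ne'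
  · exact lt_of_le_of_ne (ha v) (Ne.symm (Finsupp.mem_support_iff.1 hv))
  · exact lt_of_le_of_ne (Realization.nonneg _ w) (Ne.symm (Finsupp.mem_support_iff.1 hw))

theorem exists_mem_carrier {a : V' →₀ ℝ} {w : V} (hw : w ∈ (S.push a).support) :
    ∃ v ∈ a.support, w ∈ S.carrier v := by
  rw [Finsupp.mem_support_iff, S.push_apply subset_rfl] at hw
  obtain ⟨v, hv, hne⟩ := Finset.exists_ne_zero_of_sum_ne_zero hw
  exact ⟨v, hv, Finsupp.mem_support_iff.2 (right_ne_zero_of_mul hne)⟩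

theorem exists_carrier_subset {s : Finset V'} (hs : s ∈ K'.faces) :
    ∃ t ∈ K.faces, ∀ v ∈ s, S.carrier v ⊆ t := by
  obtain ⟨t, ht, h⟩ := S.exists_face s hs
  refine ⟨t, ht, fun v hv => h (vertex K' v) ?_⟩
  simpa [closedSimplex, vertex, Finsupp.support_single] using hv

/-- Every vertex of `K` is a vertex of the subdivision. -/
theorem exists_vertex (v : V) : ∃ v', S.homeo (vertex K' v') = vertex K v := by
  obtain ⟨v', hv'⟩ := support_nonempty (S.homeo.symm (vertex K v))
  refine ⟨v', eq_vertex fun w hw => ?_⟩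
  have := S.carrier_subset_support_push (Realization.nonneg _) hv' hw
  rw [← homeo_weight, S.homeo.apply_symm_apply] at this
  simpa [vertex, Finsupp.support_single] using this

theorem finite_setOf_carrier_subset {s : Finset V} (hs : s ∈ K.faces) :
    {v | S.carrier v ⊆ s}.Finite :=
  finite_setOf_vertex_mem (C := S.homeo ⁻¹' closedSimplex K s)
    (S.homeo.isCompact_preimage.2 (isCompact_closedSimplex hs))

variable [LinearOrder V]

/-- A triangulation of `|K| × I` which restricts to `K` and `K'` at its ends and which has no
other vertices. Its simplices are the joins of a simplex `s` of `K` and a simplex `s'` of `K'` (one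
of which may be empty) such that `s` and the carrier of `s'` span a simplex of `K`, in which every
vertex of `s` lies below the carrier of `s'`: the prism over an ordered simplex `v₀ < ⋯ < vₙ` is
the union of the joins of `v₀ ⋯ vᵢ` and the subdivided simplex `vᵢ ⋯ vₙ`. -/
def cylinder : AbstractSimplicialComplex (V ⊕ V') where
  faces := {t | (t.toRight.Nonempty → t.toRight ∈ K'.faces) ∧
    t.toLeft ∪ t.toRight.biUnion S.carrier ∈ K.faces ∧
    ∀ u ∈ t.toLeft, ∀ v ∈ t.toRight, ∀ w ∈ S.carrier v, u ≤ w}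
  isRelLowerSet_faces := by
    intro t ht
    have hne : ∀ t : Finset (V ⊕ V'), t.Nonempty →
        (t.toLeft ∪ t.toRight.biUnion S.carrier).Nonempty := by
      rintro t ⟨u | v, h⟩
      · exact ⟨u, by simp [h]⟩
      · obtain ⟨w, hw⟩ := S.carrier_nonempty v
        exact ⟨w, Finset.mem_union_right _ (Finset.mem_biUnion.2 ⟨v, by simpa using h, hw⟩)⟩
    refine ⟨?_, fun t' ht' hne' => ⟨fun h => ?_, ?_, ?_⟩⟩
    · obtain ⟨w, hw⟩ := (K.isRelLowerSet_faces ht.2.1).1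
      rcases Finset.mem_union.1 hw with h | h
      · exact ⟨_, Finset.mem_toLeft.1 h⟩
      · obtain ⟨v, hv, -⟩ := Finset.mem_biUnion.1 h
        exact ⟨_, Finset.mem_toRight.1 hv⟩
    · have hsub := Finset.toRight_subset_toRight ht'
      exact mem_faces_of_subset (ht.1 (h.mono hsub)) hsub h
    · refine mem_faces_of_subset ht.2.1 ?_ (hne t' hne')
      exact Finset.union_subset_union (Finset.toLeft_subset_toLeft ht')
        (Finset.biUnion_subset_biUnion_of_subset_left _ (Finset.toRight_subset_toRight ht'))
    · intro u hu v hv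
      exact ht.2.2 u (Finset.toLeft_subset_toLeft ht' hu) v (Finset.toRight_subset_toRight ht' hv)
  singleton_mem := by
    rintro (u | v)
    · have h₁ : ({Sum.inl u} : Finset (V ⊕ V')).toLeft = {u} := by ext; simp
      have h₂ : ({Sum.inl u} : Finset (V ⊕ V')).toRight = ∅ := by ext; simp
      refine ⟨by simp [h₂], ?_, by simp [h₂]⟩
      rw [h₁, h₂]
      simpa using K.singleton_mem u
    · have h₁ : ({Sum.inr v} : Finset (V ⊕ V')).toLeft = ∅ := by ext; simp
      have h₂ : ({Sum.inr v} : Finset (V ⊕ V')).toRight = {v} := by ext; simp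
      refine ⟨fun _ => by rw [h₂]; exact K'.singleton_mem v, ?_, by simp [h₁]⟩
      rw [h₁, h₂]
      simpa [carrier] using (S.homeo (vertex K' v)).support_mem

/-- The vertices of the cylinder at the lower end. -/
def embLeft : Emb K S.cylinder where
  toFun := .inl
  map_mem s hs := by
    have h₁ : (s.map Function.Embedding.inl : Finset (V ⊕ V')).toLeft = s := by ext; simp
    have h₂ : (s.map Function.Embedding.inl : Finset (V ⊕ V')).toRight = ∅ := by ext; simp
    refine ⟨by simp [h₂], ?_, by simp [h₂]⟩
    rw [h₁, h₂]
    simpa using hs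

/-- The vertices of the cylinder at the upper end. -/
def embRight : Emb K' S.cylinder where
  toFun := .inr
  map_mem s hs := by
    have h₁ : (s.map Function.Embedding.inr : Finset (V ⊕ V')).toLeft = ∅ := by ext; simp
    have h₂ : (s.map Function.Embedding.inr : Finset (V ⊕ V')).toRight = s := by ext; simp
    refine ⟨fun _ => by rwa [h₂], ?_, by simp [h₁]⟩
    rw [h₁, h₂, Finset.empty_union]
    obtain ⟨t, ht, hst⟩ := S.exists_carrier_subset hs
    refine mem_faces_of_subset ht (Finset.biUnion_subset.2 hst) ?_
    obtain ⟨v, hv⟩ := (K'.isRelLowerSet_faces hs).1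
    obtain ⟨w, hw⟩ := S.carrier_nonempty v
    exact ⟨w, Finset.mem_biUnion.2 ⟨v, hv, hw⟩⟩

end Subdivision

namespace Realization

variable {V V' : Type u}

/-- The coordinates at the vertices of the lower end. -/
noncomputable def left : (V ⊕ V' →₀ ℝ) →ₗ[ℝ] (V →₀ ℝ) :=
  Finsupp.lcomapDomain Sum.inl Sum.inl_injective

/-- The coordinates at the vertices of the upper end. -/
noncomputable def right : (V ⊕ V' →₀ ℝ) →ₗ[ℝ] (V' →₀ ℝ) :=
  Finsupp.lcomapDomain Sum.inr Sum.inr_injective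

@[simp] theorem left_apply (x : V ⊕ V' →₀ ℝ) (v : V) : left x v = x (Sum.inl v) := rfl

@[simp] theorem right_apply (x : V ⊕ V' →₀ ℝ) (v : V') : right x v = x (Sum.inr v) := rfl

theorem support_left (x : V ⊕ V' →₀ ℝ) : (left x).support = x.support.toLeft := by
  ext v; simp

theorem support_right (x : V ⊕ V' →₀ ℝ) : (right x).support = x.support.toRight := by
  ext v; simp

theorem mass_left_add_mass_right (x : V ⊕ V' →₀ ℝ) : mass (left x) + mass (right x) = mass x := by
  rw [mass_eq_sum subset_rfl, mass_eq_sum subset_rfl, mass_eq_sum (x := x) subset_rfl,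
    support_left, support_right, ← Finset.toLeft_disjSum_toRight (u := x.support),
    Finset.sum_disjSum]
  simp

end Realization

namespace Subdivision

variable {V V' : Type u} {K' : AbstractSimplicialComplex V'} {K : AbstractSimplicialComplex V}
  (S : Subdivision K' K)

/-- The projection of the cylinder to `|K|`, on vectors of coordinates. -/
noncomputable def proj : (V ⊕ V' →₀ ℝ) →ₗ[ℝ] (V →₀ ℝ) :=
  left + S.push ∘ₗ right

theorem proj_apply (x : V ⊕ V' →₀ ℝ) : S.proj x = left x + S.push (right x) := rfl

theorem mass_proj (x : V ⊕ V' →₀ ℝ) : mass (S.proj x) = mass x := by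
  rw [proj_apply, map_add, mass_push, mass_left_add_mass_right]

/-- The point of `|K|` below a vertex of the cylinder. -/
noncomputable def point : V ⊕ V' → V →₀ ℝ :=
  Sum.elim (fun v => (vertex K v).weight) fun v => (S.homeo (vertex K' v)).weight

theorem support_left_subset {x : V ⊕ V' →₀ ℝ} (hx : ∀ v, 0 ≤ x v) :
    (left x).support ⊆ (S.proj x).support := by
  intro v hv
  rw [Finsupp.mem_support_iff, proj_apply, Finsupp.add_apply]
  have h₁ : 0 < left x v := lt_of_le_of_ne (hx _) (Ne.symm (Finsupp.mem_support_iff.1 hv))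
  have h₂ : 0 ≤ S.push (right x) v := S.push_nonneg (fun w => hx _) v
  exact (by positivity : 0 < left x v + S.push (right x) v).ne'

theorem support_push_right_subset {x : V ⊕ V' →₀ ℝ} (hx : ∀ v, 0 ≤ x v) :
    (S.push (right x)).support ⊆ (S.proj x).support := by
  intro v hv
  rw [Finsupp.mem_support_iff, proj_apply, Finsupp.add_apply]
  have h₁ : 0 < S.push (right x) v := lt_of_le_of_ne (S.push_nonneg (fun w => hx _) v)
    (Ne.symm (Finsupp.mem_support_iff.1 hv))
  have h₂ : 0 ≤ left x v := hx _
  exact (by positivity : 0 < left x v + S.push (right x) v).ne'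

variable [LinearOrder V]

theorem support_proj_subset (x : V ⊕ V' →₀ ℝ) : (S.proj x).support ⊆
    (left x).support ∪ (S.push (right x)).support := by
  rw [proj_apply]
  convert Finsupp.support_add

/-- The smallest simplex of `K` below a simplex of the cylinder. -/
noncomputable def base (t : Finset (V ⊕ V')) : Finset V :=
  t.toLeft ∪ t.toRight.biUnion S.carrier

theorem base_mem {t : Finset (V ⊕ V')} (ht : t ∈ S.cylinder.faces) : S.base t ∈ K.faces := ht.2.1

theorem support_push_right_subset_biUnion {x : V ⊕ V' →₀ ℝ} {t : Finset (V ⊕ V')}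
    (hx : x.support ⊆ t) : (S.push (right x)).support ⊆ t.toRight.biUnion S.carrier := by
  intro w hw
  obtain ⟨v, hv, hw⟩ := S.exists_mem_carrier hw
  rw [support_right] at hv
  exact Finset.mem_biUnion.2 ⟨v, Finset.toRight_subset_toRight hx hv, hw⟩

theorem support_proj_subset_base {x : V ⊕ V' →₀ ℝ} {t : Finset (V ⊕ V')} (hx : x.support ⊆ t) :
    (S.proj x).support ⊆ S.base t := by
  refine (S.support_proj_subset x).trans (Finset.union_subset_union ?_
    (S.support_push_right_subset_biUnion hx))
  rw [support_left]
  exact Finset.toLeft_subset_toLeft hx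

theorem point_mem_cell {t : Finset (V ⊕ V')} {w : V ⊕ V'} (hw : w ∈ t) :
    S.point w ∈ cell (S.base t) := by
  cases w with
  | inl v =>
    refine weight_mem_cell fun u hu => Finset.mem_union_left _ ?_
    have : u = v := by simpa [vertex, Finsupp.support_single] using hu
    simpa [this] using hw
  | inr v =>
    refine weight_mem_cell fun u hu => Finset.mem_union_right _ ?_
    exact Finset.mem_biUnion.2 ⟨v, by simpa using hw, hu⟩

/-- The homeomorphism `|S.cylinder| ≃ |K| × I`, which is affine on each simplex. -/
noncomputable def cylinderMap (x : Realization S.cylinder) : Realization K × unitInterval :=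
  ({ weight := S.proj x.weight
     nonneg := fun v => by
      rw [proj_apply, Finsupp.add_apply]
      exact add_nonneg (x.nonneg _) (S.push_nonneg (fun w => x.nonneg _) v)
     sum_eq_one := by rw [← mass_apply, mass_proj, mass_weight]
     support_mem := by
      refine mem_faces_of_subset (S.base_mem x.support_mem)
        (S.support_proj_subset_base subset_rfl) ?_
      rw [Finset.nonempty_iff_ne_empty, Ne, Finsupp.support_eq_empty]
      intro h
      have := S.mass_proj x.weight
      rw [h, mass_weight, map_zero] at this
      exact zero_ne_one this },
   ⟨mass (right x.weight), mass_nonneg fun v => x.nonneg _, by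
      have h₁ := mass_left_add_mass_right x.weight
      have h₂ : 0 ≤ mass (left x.weight) := mass_nonneg fun v => x.nonneg _
      rw [mass_weight] at h₁
      linarith⟩)

theorem cylinderMap_weight (x : Realization S.cylinder) :
    (S.cylinderMap x).1.weight = S.proj x.weight := rfl

theorem cylinderMap_height (x : Realization S.cylinder) :
    ((S.cylinderMap x).2 : ℝ) = mass (right x.weight) := rfl

theorem cylinderMap_injective : Function.Injective S.cylinderMap := by
  intro x y hxy
  have h₁ : S.proj x.weight = S.proj y.weight :=
    congrArg (fun z : Realization K × unitInterval => z.1.weight) hxy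
  have h₂ : mass (right x.weight) = mass (right y.weight) :=
    congrArg (fun z : Realization K × unitInterval => (z.2 : ℝ)) hxy
  have hle : ∀ z : Realization S.cylinder, ∀ u ∈ (left z.weight).support,
      ∀ w ∈ (S.push (right z.weight)).support, u ≤ w := by
    intro z u hu w hw
    obtain ⟨v, hv, hw⟩ := S.exists_mem_carrier hw
    rw [support_left] at hu
    rw [support_right] at hv
    exact z.support_mem.2.2 u hu v hv w hw
  have hleft : left x.weight = left y.weight := by
    refine split_unique h₁ (fun v => x.nonneg _) (S.push_nonneg fun v => x.nonneg _)
      (fun v => y.nonneg _) (S.push_nonneg fun v => y.nonneg _) ?_ (hle x) (hle y)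
    have hx := mass_left_add_mass_right x.weight
    have hy := mass_left_add_mass_right y.weight
    rw [mass_weight] at hx hy
    linarith
  have hpush : S.push (right x.weight) = S.push (right y.weight) := by
    rw [proj_apply, proj_apply, hleft] at h₁
    exact add_left_cancel h₁
  have hright : right x.weight = right y.weight := by
    by_cases h₀ : mass (right x.weight) = 0
    · rw [eq_zero_of_mass_eq_zero (x := right x.weight) (fun v => x.nonneg _) h₀,
        eq_zero_of_mass_eq_zero (x := right y.weight) (fun v => y.nonneg _) (h₂ ▸ h₀)]
    · -- after rescaling, both upper parts are points of `|K'|` with the same image in `|K|`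
      have hpoint : ∀ z : Realization S.cylinder, mass (right z.weight) ≠ 0 →
          ∃ z' : Realization K', z'.weight = (mass (right z.weight))⁻¹ • right z.weight := by
        intro z hz
        have hpos : 0 ≤ (mass (right z.weight))⁻¹ := inv_nonneg.2 (mass_nonneg fun v => z.nonneg _)
        have hne : z.weight.support.toRight.Nonempty := by
          rw [← support_right, Finset.nonempty_iff_ne_empty, Ne, Finsupp.support_eq_empty]
          intro h
          rw [h, map_zero] at hz
          exact hz rfl
        obtain ⟨z', hz', -⟩ := exists_weight_eq (K := K') (z.support_mem.1 hne)
          (y := (mass (right z.weight))⁻¹ • right z.weight)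
          ⟨fun v => mul_nonneg hpos (z.nonneg _), by
            rw [map_smul, smul_eq_mul, inv_mul_cancel₀ hz], by
            rw [← support_right]
            exact Finsupp.support_smul⟩
        exact ⟨z', hz'⟩
      obtain ⟨x', hx'⟩ := hpoint x h₀
      obtain ⟨y', hy'⟩ := hpoint y (h₂ ▸ h₀)
      have : x' = y' := by
        apply S.homeo.injective
        apply Realization.ext
        rw [homeo_weight, homeo_weight, hx', hy', map_smul, map_smul, hpush, h₂]
      rw [this, hy', h₂] at hx'
      exact (smul_right_injective _ (inv_ne_zero (h₂ ▸ h₀)) hx').symm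
  ext w
  cases w with
  | inl v => exact DFunLike.congr_fun hleft v
  | inr v => exact DFunLike.congr_fun hright v

theorem cylinderMap_surjective : Function.Surjective S.cylinderMap := by
  classical
  rintro ⟨y, r⟩
  obtain ⟨a, b, hab, ha, hb, hma, hle⟩ := exists_split y.weight y.nonneg (m := 1 - r)
    (sub_nonneg.2 r.2.2) (by rw [mass_weight]; linarith [r.2.1])
  have hmb : mass b = r := by
    have := mass_weight y
    rw [← hab, map_add, hma] at this
    linarith
  have hsub : ∀ c d : V →₀ ℝ, (∀ v, 0 ≤ c v) → (∀ v, 0 ≤ d v) → c + d = y.weight →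
      c.support ⊆ y.weight.support := by
    intro c d hc hd hcd v hv
    rw [Finsupp.mem_support_iff, ← hcd, Finsupp.add_apply]
    have h₁ : 0 < c v := lt_of_le_of_ne (hc v) (Ne.symm (Finsupp.mem_support_iff.1 hv))
    have h₂ := hd v
    positivity
  have ha_sub := hsub a b ha hb hab
  have hb_sub := hsub b a hb ha (by rw [add_comm, hab])
  obtain ⟨b', hb', hpush, hface, hcarrier⟩ : ∃ b' : V' →₀ ℝ, (∀ v, 0 ≤ b' v) ∧ S.push b' = b ∧
      (b'.support.Nonempty → b'.support ∈ K'.faces) ∧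
      ∀ v ∈ b'.support, S.carrier v ⊆ b.support := by
    by_cases hr : (r : ℝ) = 0
    · refine ⟨0, by simp, ?_, by simp, by simp⟩
      rw [map_zero, eq_zero_of_mass_eq_zero hb (hmb.trans hr)]
    · have hrpos : 0 < (r : ℝ) := lt_of_le_of_ne r.2.1 (Ne.symm hr)
      obtain ⟨z, hz, -⟩ := exists_weight_eq (K := K) y.support_mem (y := (r : ℝ)⁻¹ • b)
        ⟨fun v => mul_nonneg (inv_nonneg.2 hrpos.le) (hb v), by
          rw [map_smul, hmb, smul_eq_mul, inv_mul_cancel₀ hr],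
          Finsupp.support_smul.trans hb_sub⟩
      have hpush : S.push ((r : ℝ) • (S.homeo.symm z).weight) = b := by
        rw [map_smul, ← homeo_weight, S.homeo.apply_symm_apply, hz, smul_smul,
          mul_inv_cancel₀ hr, one_smul]
      have hnonneg : ∀ v, 0 ≤ ((r : ℝ) • (S.homeo.symm z).weight) v := fun v =>
        mul_nonneg hrpos.le (Realization.nonneg _ v)
      refine ⟨(r : ℝ) • (S.homeo.symm z).weight, hnonneg, hpush, fun h => ?_, fun v hv => ?_⟩
      · exact mem_faces_of_subset (S.homeo.symm z).support_mem Finsupp.support_smul h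
      · rw [← hpush]
        exact S.carrier_subset_support_push hnonneg hv
  let x : V ⊕ V' →₀ ℝ := Finsupp.sumElim a b'
  have hxl : left x = a := by ext v; simp [x]
  have hxr : right x = b' := by ext v; simp [x]
  have hproj : S.proj x = y.weight := by rw [proj_apply, hxl, hxr, hpush, hab]
  have hx : ∀ w, 0 ≤ x w := by
    rintro (v | v)
    · exact ha v
    · exact hb' v
  have hxlt : x.support.toLeft = a.support := by rw [← support_left, hxl]
  have hxrt : x.support.toRight = b'.support := by rw [← support_right, hxr]
  have hbase : S.base x.support = y.weight.support := by
    apply Finset.Subset.antisymm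
    · rw [base, hxlt, hxrt]
      exact Finset.union_subset ha_sub
        (Finset.biUnion_subset.2 fun v hv => (hcarrier v hv).trans hb_sub)
    · rw [← hproj]
      exact S.support_proj_subset_base subset_rfl
  refine ⟨⟨x, hx, ?_, ?_, ?_, ?_⟩, Prod.ext (Realization.ext hproj) (Subtype.ext ?_)⟩
  · rw [← mass_apply, ← S.mass_proj, hproj, mass_weight]
  · rw [hxrt]
    exact hface
  · have : S.base x.support ∈ K.faces := by
      rw [hbase]
      exact y.support_mem
    exact this
  · intro u hu v hv w hw
    rw [hxlt] at hu
    rw [hxrt] at hv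
    exact hle u hu w (hcarrier v hv hw)
  · rw [cylinderMap_height]
    change mass (right x) = r
    rw [hxr, ← S.mass_push, hpush, hmb]

theorem continuous_cylinderMap : Continuous S.cylinderMap := by
  refine isQuotientMap_ofStdSimplex.continuous_iff.2 (continuous_sigma ?_)
  rintro ⟨t, ht⟩
  have hweight : ∀ w, Continuous fun a : stdSimplex ℝ t => (ofStdSimplex ht a).weight w :=
    fun w => (continuous_weight w).comp (continuous_ofStdSimplex ht)
  have hsupp : ∀ a : stdSimplex ℝ t, (right (ofStdSimplex ht a).weight).support ⊆ t.toRight := by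
    intro a
    rw [support_right]
    exact Finset.toRight_subset_toRight (ofStdSimplex_mem ht a)
  refine Continuous.prodMk ?_ ?_
  · refine continuous_of_closedSimplex (S.base_mem ht)
      (fun a => S.support_proj_subset_base (ofStdSimplex_mem ht a)) fun v => ?_
    have : ∀ a : stdSimplex ℝ t, S.proj (ofStdSimplex ht a).weight v =
        (ofStdSimplex ht a).weight (Sum.inl v) + ∑ w ∈ t.toRight,
          (ofStdSimplex ht a).weight (Sum.inr w) * (S.homeo (vertex K' w)).weight v := by
      intro a
      rw [proj_apply, Finsupp.add_apply, S.push_apply (hsupp a)]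
      rfl
    change Continuous fun a : stdSimplex ℝ t => S.proj (ofStdSimplex ht a).weight v
    simp only [this]
    exact (hweight _).add (continuous_finsetSum _ fun w _ => (hweight _).mul continuous_const)
  · refine continuous_induced_rng.2 ?_
    have : ∀ a : stdSimplex ℝ t, mass (right (ofStdSimplex ht a).weight) =
        ∑ w ∈ t.toRight, (ofStdSimplex ht a).weight (Sum.inr w) := fun a => mass_eq_sum (hsupp a)
    change Continuous fun a : stdSimplex ℝ t => mass (right (ofStdSimplex ht a).weight)
    simp only [this]
    exact continuous_finsetSum _ fun w _ => hweight _

/-- The homeomorphism `|S.cylinder| ≃ |K| × I`. -/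
noncomputable def cylinderHomeo : Realization S.cylinder ≃ₜ Realization K × unitInterval where
  toEquiv := Equiv.ofBijective _ ⟨S.cylinderMap_injective, S.cylinderMap_surjective⟩
  continuous_toFun := S.continuous_cylinderMap
  continuous_invFun := by
    refine continuous_symm_of_finite (Equiv.ofBijective _
      ⟨S.cylinderMap_injective, S.cylinderMap_surjective⟩) S.continuous_cylinderMap fun s hs => ?_
    refine ⟨s.disjSum (S.finite_setOf_carrier_subset hs).toFinset, fun y hy => ?_⟩
    have hy : (S.proj y.weight).support ⊆ s := hy
    rw [Finset.subset_disjSum, ← support_left, ← support_right]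
    refine ⟨(S.support_left_subset y.nonneg).trans hy, fun v hv => ?_⟩
    rw [Set.Finite.mem_toFinset]
    exact (S.carrier_subset_support_push (fun w => y.nonneg _) hv).trans
      ((S.support_push_right_subset y.nonneg).trans hy)

theorem cylinderHomeo_apply (x : Realization S.cylinder) : S.cylinderHomeo x = S.cylinderMap x :=
  rfl

theorem cylinderHomeo_embLeft (x : Realization K) :
    S.cylinderHomeo (S.embLeft.realize x) = (x, 0) := by
  have hl : left (S.embLeft.realize x).weight = x.weight := by
    ext v
    exact Finsupp.embDomain_apply_self _ _ _
  have hr : right (S.embLeft.realize x).weight = 0 := by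
    ext v
    refine Finsupp.embDomain_of_notMem_range _ _ _ ?_
    rintro ⟨u, hu⟩
    cases hu
  refine Prod.ext (Realization.ext ?_) (Subtype.ext ?_)
  · rw [cylinderHomeo_apply, cylinderMap_weight, proj_apply, hl, hr, map_zero, add_zero]
  · rw [cylinderHomeo_apply, cylinderMap_height, hr, map_zero]
    rfl

theorem cylinderHomeo_embRight (x : Realization K') :
    S.cylinderHomeo (S.embRight.realize x) = (S.homeo x, 1) := by
  have hl : left (S.embRight.realize x).weight = 0 := by
    ext v
    refine Finsupp.embDomain_of_notMem_range _ _ _ ?_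
    rintro ⟨u, hu⟩
    cases hu
  have hr : right (S.embRight.realize x).weight = x.weight := by
    ext v
    exact Finsupp.embDomain_apply_self _ _ _
  refine Prod.ext (Realization.ext ?_) (Subtype.ext ?_)
  · rw [cylinderHomeo_apply, cylinderMap_weight, proj_apply, hl, hr, zero_add, homeo_weight]
  · rw [cylinderHomeo_apply, cylinderMap_height, hr, mass_weight]
    rfl

theorem cylinderHomeo_vertex_fst (w : V ⊕ V') :
    (S.cylinderHomeo (vertex S.cylinder w)).1.weight = S.point w := by
  rw [cylinderHomeo_apply, cylinderMap_weight, proj_apply]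
  cases w with
  | inl v =>
    have hl : left (vertex S.cylinder (Sum.inl v)).weight = Finsupp.single v 1 := by
      ext u; exact Finsupp.single_apply_left Sum.inl_injective _ _ _
    have hr : right (vertex S.cylinder (Sum.inl v)).weight = 0 := by
      ext u; simp [vertex]
    rw [hl, hr, map_zero, add_zero]
    rfl
  | inr v =>
    have hl : left (vertex S.cylinder (Sum.inr v)).weight = 0 := by
      ext u; simp [vertex]
    have hr : right (vertex S.cylinder (Sum.inr v)).weight = Finsupp.single v 1 := by
      ext u; exact Finsupp.single_apply_left Sum.inr_injective _ _ _
    rw [hl, hr, push_single, zero_add]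
    rfl

/-- The segment over a vertex of `K` is triangulated by a single edge. -/
theorem exists_edge (v : V) : ∃ t ∈ S.cylinder.faces,
    S.cylinderHomeo '' closedSimplex S.cylinder t = {vertex K v} ×ˢ Set.univ := by
  classical
  obtain ⟨v', hv'⟩ := S.exists_vertex v
  have hcarrier : S.carrier v' = {v} := by
    rw [carrier, hv']
    simp [vertex, Finsupp.support_single]
  have hl : ({Sum.inl v, Sum.inr v'} : Finset (V ⊕ V')).toLeft = {v} := by ext; simp
  have hr : ({Sum.inl v, Sum.inr v'} : Finset (V ⊕ V')).toRight = {v'} := by ext; simp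
  have hbase : S.base {Sum.inl v, Sum.inr v'} = {v} := by
    rw [base, hl, hr]
    simp [hcarrier]
  refine ⟨{Sum.inl v, Sum.inr v'}, ⟨fun _ => by rw [hr]; exact K'.singleton_mem v', ?_, ?_⟩, ?_⟩
  · have := K.singleton_mem v
    rwa [← hbase] at this
  · simp [hl, hr, hcarrier]
  ext ⟨x, r⟩
  simp only [Set.mem_image, Set.mem_prod, Set.mem_singleton_iff, Set.mem_univ, and_true]
  constructor
  · rintro ⟨y, hy, hyx⟩
    obtain rfl : (S.cylinderHomeo y).1 = x := congrArg Prod.fst hyx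
    exact eq_vertex (hbase ▸ S.support_proj_subset_base hy)
  · rintro rfl
    refine ⟨S.cylinderHomeo.symm (vertex K v, r), ?_, S.cylinderHomeo.apply_symm_apply _⟩
    set y := S.cylinderHomeo.symm (vertex K v, r) with hy
    have hproj : S.proj y.weight = (vertex K v).weight := by
      rw [← cylinderMap_weight, ← cylinderHomeo_apply, hy, S.cylinderHomeo.apply_symm_apply]
    have hsupp : (S.proj y.weight).support ⊆ {v} := by
      rw [hproj]
      simp [vertex, Finsupp.support_single]
    rintro (u | u) hu
    · have : u ∈ (left y.weight).support := by simpa using hu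
      have := hsupp (S.support_left_subset y.nonneg this)
      simpa using this
    · have hu' : u ∈ (right y.weight).support := by simpa using hu
      have := (S.carrier_subset_support_push (fun w => y.nonneg _) hu').trans
        ((S.support_push_right_subset y.nonneg).trans hsupp)
      have : vertex K' u = vertex K' v' := S.homeo.injective ((eq_vertex this).trans hv'.symm)
      simp [vertex_injective this]

end Subdivision

end AbstractSimplicialComplex

/-! ### Formal maps on the cylinder -/

namespace FormalMap

open CrossedModule AffineChain

variable {C : Type v} {P : Type w} [Group C] [Group P] [MulDistribMulAction P C]
  {𝒞 : CrossedModule C P}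

section

variable {V : Type u} {K : AbstractSimplicialComplex V} (o : PartialOrder V)

theorem exists_lt_of_simplex_one (ho : ∀ s ∈ K.faces, ∀ u ∈ s, ∀ v ∈ s, o.le u v ∨ o.le v u)
    (e : K.Simplex 1) : ∃ x y, o.lt x y ∧ (e.1 : Set V) = {x, y} := by
  classical
  obtain ⟨x, y, hxy, he⟩ := Finset.card_eq_two.1 e.2.2
  have hx : x ∈ e.1 := by simp [he]
  have hy : y ∈ e.1 := by simp [he]
  rcases ho e.1 e.2.1 x hx y hy with h | h
  · exact ⟨x, y, lt_of_le_of_ne h hxy, by simp [he]⟩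
  · exact ⟨y, x, lt_of_le_of_ne h hxy.symm, by simp [he, Set.pair_comm]⟩

theorem exists_lt_of_simplex_two (ho : ∀ s ∈ K.faces, ∀ u ∈ s, ∀ v ∈ s, o.le u v ∨ o.le v u)
    (t : K.Simplex 2) : ∃ x y z, o.lt x y ∧ o.lt y z ∧ (t.1 : Set V) = {x, y, z} := by
  classical
  obtain ⟨x, y, z, hxy, hxz, hyz, ht⟩ := Finset.card_eq_three.1 t.2.2
  have hx : x ∈ t.1 := by simp [ht]
  have hy : y ∈ t.1 := by simp [ht]
  have hz : z ∈ t.1 := by simp [ht]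
  have hcoe : (t.1 : Set V) = {x, y, z} := by simp [ht]
  have hlt : ∀ a ∈ t.1, ∀ b ∈ t.1, a ≠ b → o.lt a b ∨ o.lt b a := fun a ha b hb hab =>
    (ho t.1 t.2.1 a ha b hb).imp (fun h => lt_of_le_of_ne h hab)
      fun h => lt_of_le_of_ne h hab.symm
  rw [hcoe]
  have perm : ∀ a b c : V, (∀ d, d = a ∨ d = b ∨ d = c ↔ d = x ∨ d = y ∨ d = z) →
      ({x, y, z} : Set V) = {a, b, c} := fun a b c h => by
    ext d
    simpa using (h d).symm
  rcases hlt x hx y hy hxy with h₁ | h₁ <;> rcases hlt y hy z hz hyz with h₂ | h₂ <;>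
    rcases hlt x hx z hz hxz with h₃ | h₃
  · exact ⟨x, y, z, h₁, h₂, rfl⟩
  · exact ⟨x, y, z, h₁, h₂, rfl⟩
  · exact ⟨x, z, y, h₃, h₂, perm _ _ _ fun d => by tauto⟩
  · exact ⟨z, x, y, h₃, h₁, perm _ _ _ fun d => by tauto⟩
  · exact ⟨y, x, z, h₁, h₃, perm _ _ _ fun d => by tauto⟩
  · exact ⟨y, z, x, h₂, h₃, perm _ _ _ fun d => by tauto⟩
  · exact ⟨z, y, x, h₂, h₁, perm _ _ _ fun d => by tauto⟩
  · exact ⟨z, y, x, h₂, h₁, perm _ _ _ fun d => by tauto⟩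

theorem pair_unique {x y x' y' : V} (h : o.lt x y) (h' : o.lt x' y')
    (heq : ({x, y} : Set V) = {x', y'}) : x = x' ∧ y = y' := by
  rcases Set.pair_eq_pair_iff.1 heq with h₁ | ⟨rfl, rfl⟩
  · exact h₁
  · exact absurd h' (lt_asymm (a := x) h)

theorem triple_unique {x y z x' y' z' : V} (hxy : o.lt x y) (hyz : o.lt y z)
    (hxy' : o.lt x' y') (hyz' : o.lt y' z')
    (heq : ({x, y, z} : Set V) = {x', y', z'}) : x = x' ∧ y = y' ∧ z = z' := by
  have hx : x ∈ ({x', y', z'} : Set V) := heq ▸ (by simp)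
  have hy : y ∈ ({x', y', z'} : Set V) := heq ▸ (by simp)
  have hz : z ∈ ({x', y', z'} : Set V) := heq ▸ (by simp)
  have hxz' := lt_trans (b := y') hxy' hyz'
  simp only [Set.mem_insert_iff, Set.mem_singleton_iff] at hx hy hz
  have hxz := lt_trans (b := y) hxy hyz
  -- a strictly increasing triple in a set of three elements is the only one
  rcases hx with rfl | rfl | rfl <;> rcases hy with rfl | rfl | rfl <;>
    rcases hz with rfl | rfl | rfl
  all_goals first
    | exact ⟨rfl, rfl, rfl⟩
    | exact absurd hxy (lt_irrefl _)
    | exact absurd hyz (lt_irrefl _)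
    | exact absurd hxz (lt_irrefl _)
    | exact absurd hxy (lt_asymm ‹_›)
    | exact absurd hyz (lt_asymm ‹_›)

/-- A cocycle on the simplices of `K`, and an order of the vertices, give a formal map. -/
theorem exists_of_isCocycleOn (ho : ∀ s ∈ K.faces, ∀ u ∈ s, ∀ v ∈ s, o.le u v ∨ o.le v u)
    {p : V → V → P} {c : V → V → V → C} (h : 𝒞.IsCocycleOn {U | ∃ s ∈ K.faces, U = ↑s} p c) :
    ∃ φ : FormalMap 𝒞 K, φ.order = o ∧ φ.HasLabels p c := by
  choose ex ey hexy he using exists_lt_of_simplex_one o ho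
  choose tx ty tz htxy htyz ht using exists_lt_of_simplex_two o ho
  have hp : ∀ (e : K.Simplex 1) x y, o.lt x y → (e.1 : Set V) = {x, y} →
      p (ex e) (ey e) = p x y := by
    intro e x y hxy hxye
    obtain ⟨h₁, h₂⟩ := pair_unique o (hexy e) hxy ((he e).symm.trans hxye)
    rw [h₁, h₂]
  have hc : ∀ (t : K.Simplex 2) x y z, o.lt x y → o.lt y z → (t.1 : Set V) = {x, y, z} →
      c (tx t) (ty t) (tz t) = c x y z := by
    intro t x y z hxy hyz hxyz
    obtain ⟨h₁, h₂, h₃⟩ := triple_unique o (htxy t) (htyz t) hxy hyz ((ht t).symm.trans hxyz)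
    rw [h₁, h₂, h₃]
  refine ⟨{ c := fun t => c (tx t) (ty t) (tz t), p := fun e => p (ex e) (ey e), order := o,
            total := ho, boundary := ?_, cocycle := ?_ }, rfl,
    ⟨fun x y hxy e => hp e x y hxy, fun x y z hxy hyz t => hc t x y z hxy hyz⟩⟩
  · intro x y z hxy hyz t e₀ e₁ e₂ ht h₀ h₁ h₂
    rw [hc t x y z hxy hyz ht, hp e₀ y z hyz h₀, hp e₁ x z (lt_trans (b := y) hxy hyz) h₁,
      hp e₂ x y hxy h₂]
    have hmem : ∀ a ∈ ({x, y, z} : Set V), a ∈ (t.1 : Set V) := fun a ha => ht ▸ ha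
    exact h.boundary _ ⟨t.1, t.2.1, rfl⟩ x (hmem x (by simp)) y (hmem y (by simp)) z
      (hmem z (by simp))
  · intro x y z r hxy hyz hzr s t₀ t₁ t₂ t₃ e hs h₀ h₁ h₂ h₃ h₄
    have hyr := lt_trans (b := z) hyz hzr
    rw [hc t₂ x y r hxy hyr h₂, hc t₀ y z r hyz hzr h₀,
      hc t₁ x z r (lt_trans (b := y) hxy hyz) hzr h₁, hc t₃ x y z hxy hyz h₃, hp e x y hxy h₄]
    have hmem : ∀ a ∈ ({x, y, z, r} : Set V), a ∈ (s.1 : Set V) := fun a ha => hs ▸ ha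
    exact h.cocycle _ ⟨s.1, s.2.1, rfl⟩ x (hmem x (by simp)) y (hmem y (by simp)) z
      (hmem z (by simp)) r (hmem r (by simp))

end

theorem Extends.of_hasLabels {V W : Type u} {K : AbstractSimplicialComplex V}
    {T : AbstractSimplicialComplex W} {Φ : FormalMap 𝒞 T} {i : Emb K T} {φ : FormalMap 𝒞 K}
    {p : W → W → P} {c : W → W → W → C} (hΦ : Φ.HasLabels p c)
    (hφ : φ.HasLabels (fun x y => p (i.toFun x) (i.toFun y))
      fun x y z => c (i.toFun x) (i.toFun y) (i.toFun z))
    (hle : ∀ u v, Φ.order.le (i.toFun u) (i.toFun v) ↔ φ.order.le u v) : Φ.Extends i φ := by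
  have hlt : ∀ u v, φ.order.lt u v → Φ.order.lt (i.toFun u) (i.toFun v) := by
    intro u v huv
    rw [φ.order.lt_iff_le_not_ge] at huv
    rw [Φ.order.lt_iff_le_not_ge, hle, hle]
    exact huv
  refine ⟨fun t => ?_, fun e => ?_, hle⟩
  · obtain ⟨x, y, z, hxy, hyz, ht⟩ := exists_lt_of_simplex_two φ.order φ.total t
    rw [hφ.c_eq x y z hxy hyz t ht]
    refine hΦ.c_eq _ _ _ (hlt _ _ hxy) (hlt _ _ hyz) _ ?_
    simp [Emb.onSimplex, ht, Set.image_insert_eq]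
  · obtain ⟨x, y, hxy, he⟩ := exists_lt_of_simplex_one φ.order φ.total e
    rw [hφ.p_eq x y hxy e he]
    refine hΦ.p_eq _ _ (hlt _ _ hxy) _ ?_
    simp [Emb.onSimplex, he, Set.image_insert_eq]

/-- The order on the vertices of the cylinder in which the lower end lies below the upper end. -/
abbrev sumLexOrder {V V' : Type*} (o : PartialOrder V) (o' : PartialOrder V') :
    PartialOrder (V ⊕ V') where
  le := Sum.Lex o.le o'.le
  lt a b := Sum.Lex o.le o'.le a b ∧ ¬ Sum.Lex o.le o'.le b a
  lt_iff_le_not_ge _ _ := Iff.rfl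
  le_refl
    | .inl v => .inl (o.le_refl v)
    | .inr v => .inr (o'.le_refl v)
  le_trans := by
    rintro _ _ _ (h₁ | h₁ | h₁) (h₂ | h₂ | h₂)
    · exact .inl (o.le_trans _ _ _ h₁ h₂)
    · exact .sep _ _
    · exact .inr (o'.le_trans _ _ _ h₁ h₂)
    · exact .sep _ _
  le_antisymm := by
    rintro _ _ (h₁ | h₁ | h₁) (h₂ | h₂ | h₂)
    · exact congrArg _ (o.le_antisymm _ _ h₁ h₂)
    · exact congrArg _ (o'.le_antisymm _ _ h₁ h₂)

variable {V V' : Type u} {K' : AbstractSimplicialComplex V'} {K : AbstractSimplicialComplex V}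

/-- Formal maps on `K` and on its subdivision are equivalent if both arise from a single cocycle
on the tuples of points that lie in a common simplex of `K`. -/
theorem equivalent_of_isCocycleOn (S : Subdivision K' K) (B : Set V)
    {p : (V →₀ ℝ) → (V →₀ ℝ) → P} {c : (V →₀ ℝ) → (V →₀ ℝ) → (V →₀ ℝ) → C}
    (h : 𝒞.IsCocycleOn {U | ∃ s ∈ K.faces, U = cell s} p c)
    {φ : FormalMap 𝒞 K} {φ' : FormalMap 𝒞 K'}
    (hφ : φ.HasLabels (fun x y => p (vertex K x).weight (vertex K y).weight)
      fun x y z => c (vertex K x).weight (vertex K y).weight (vertex K z).weight)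
    (hφ' : φ'.HasLabels
      (fun x y => p (S.homeo (vertex K' x)).weight (S.homeo (vertex K' y)).weight)
      fun x y z => c (S.homeo (vertex K' x)).weight (S.homeo (vertex K' y)).weight
        (S.homeo (vertex K' z)).weight) :
    Equivalent (vertex K '' B) (Homeomorph.refl _) S.homeo φ φ' := by
  let _ : LinearOrder V := IsWellOrder.linearOrder WellOrderingRel
  have hT : 𝒞.IsCocycleOn {U | ∃ t ∈ S.cylinder.faces, U = ↑t}
      (fun x y => p (S.point x) (S.point y))
      (fun x y z => c (S.point x) (S.point y) (S.point z)) := by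
    refine h.comp S.point ?_
    rintro _ ⟨t, ht, rfl⟩
    exact ⟨_, ⟨_, S.base_mem ht, rfl⟩, fun w hw => S.point_mem_cell hw⟩
  obtain ⟨Φ, hΦo, hΦ⟩ := exists_of_isCocycleOn (K := S.cylinder)
    (sumLexOrder φ.order φ'.order) (by
      rintro t ht (u | u) hu (v | v) hv
      · exact (φ.total _ (S.base_mem ht) u (Finset.mem_union_left _ (by simpa using hu)) v
          (Finset.mem_union_left _ (by simpa using hv))).imp .inl .inl
      · exact .inl (.sep _ _)
      · exact .inr (.sep _ _)
      · exact (φ'.total _ (ht.1 ⟨u, by simpa using hu⟩) u (by simpa using hu) v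
          (by simpa using hv)).imp .inr .inr) hT
  refine ⟨?_, V ⊕ V', S.cylinder, S.cylinderHomeo, S.embLeft, S.embRight, Φ,
    S.cylinderHomeo_embLeft, S.cylinderHomeo_embRight, ?_, ?_, ?_⟩
  · rintro _ ⟨v, -, rfl⟩
    exact ⟨⟨v, rfl⟩, S.exists_vertex v⟩
  · refine Extends.of_hasLabels hΦ hφ fun u v => ?_
    rw [hΦo]
    exact Sum.lex_inl_inl
  · refine Extends.of_hasLabels hΦ hφ' fun u v => ?_
    rw [hΦo]
    exact Sum.lex_inr_inr
  · rintro _ ⟨v, -, rfl⟩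
    refine ⟨fun r => ?_, fun e he => ?_⟩
    · obtain ⟨t, ht, heq⟩ := S.exists_edge v
      exact ⟨t, ht, heq ▸ ⟨rfl, trivial⟩, heq.le⟩
    · -- both end points of the edge lie over `v`, so that its label is that of a constant pair
      have hpoint : ∀ w ∈ e.1, S.point w = (vertex K v).weight := by
        intro w hw
        rw [← S.cylinderHomeo_vertex_fst w]
        refine congrArg Realization.weight (he ⟨_, ?_, rfl⟩).1
        simpa [closedSimplex, vertex, Finsupp.support_single] using hw
      obtain ⟨x, y, hxy, hexy⟩ := exists_lt_of_simplex_one Φ.order Φ.total e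
      have hmem : ∀ a ∈ ({x, y} : Set (V ⊕ V')), a ∈ (e.1 : Set (V ⊕ V')) :=
        fun a ha => hexy ▸ ha
      rw [hΦ.p_eq x y hxy e hexy, hpoint x (hmem x (by simp)), hpoint y (hmem y (by simp))]
      exact h.p_self _ ⟨_, K.singleton_mem v, rfl⟩ _
        (weight_mem_cell (by simp [vertex, Finsupp.support_single]))

end FormalMap

/-! ### Cocycles on the closed simplices -/

namespace AbstractSimplicialComplex

open AffineChain

namespace Realization

variable {V : Type u} {K : AbstractSimplicialComplex V}

theorem exists_forall_weight_le (x : Realization K) : ∃ v, ∀ u, x.weight u ≤ x.weight v := by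
  obtain ⟨v, hv, hmax⟩ := x.weight.support.exists_max_image x.weight (support_nonempty x)
  refine ⟨v, fun u => ?_⟩
  by_cases hu : u ∈ x.weight.support
  · exact hmax u hu
  · rw [Finsupp.notMem_support_iff.1 hu]
    exact x.nonneg v

/-- A vertex at which the weight of `x` is maximal. -/
noncomputable def maxVertex (x : Realization K) : V := (exists_forall_weight_le x).choose

theorem weight_le_maxVertex (x : Realization K) (u : V) : x.weight u ≤ x.weight x.maxVertex :=
  (exists_forall_weight_le x).choose_spec u

theorem maxVertex_mem (x : Realization K) : x.maxVertex ∈ x.weight.support := by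
  obtain ⟨v, hv⟩ := support_nonempty x
  rw [Finsupp.mem_support_iff] at hv ⊢
  exact ((lt_of_le_of_ne (x.nonneg v) (Ne.symm hv)).trans_le (weight_le_maxVertex x v)).ne'

theorem maxVertex_vertex (v : V) : (vertex K v).maxVertex = v := by
  have := maxVertex_mem (vertex K v)
  simpa [vertex, Finsupp.support_single] using this

/-- The points whose weight is maximal at vertices of `s` only. -/
def maxIn (K : AbstractSimplicialComplex V) (s : Finset V) : Set (Realization K) :=
  {x | ∀ w, (∀ u, x.weight u ≤ x.weight w) → w ∈ s}

theorem isOpen_maxIn (s : Finset V) : IsOpen (maxIn K s) := by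
  rw [← isClosed_compl_iff]
  refine isClosed_of_closedSimplex fun t _ =>
    ⟨⋃ w ∈ (t : Set V) \ s, ⋂ u ∈ t, {x | x.weight u ≤ x.weight w}, ?_, fun x hx => ?_⟩
  · refine (t.finite_toSet.subset Set.sdiff_subset).isClosed_biUnion fun w _ => ?_
    exact isClosed_biInter fun u _ => isClosed_le (continuous_weight u) (continuous_weight w)
  · simp only [maxIn, Set.mem_compl_iff, Set.mem_ofPred_eq, not_forall, Set.mem_iUnion,
      Set.mem_iInter, Set.mem_sdiff, Finset.mem_coe]
    constructor
    · rintro ⟨w, hmax, hws⟩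
      refine ⟨w, ⟨hx (Finsupp.mem_support_iff.2 fun h₀ => ?_), hws⟩, fun u _ => hmax u⟩
      have h₁ := hmax x.maxVertex
      have h₂ := Finsupp.mem_support_iff.1 (maxVertex_mem x)
      exact h₂ (le_antisymm (h₁.trans h₀.le) (x.nonneg _))
    · rintro ⟨w, ⟨_, hws⟩, hmax⟩
      refine ⟨w, fun u => ?_, hws⟩
      by_cases hu : u ∈ t
      · exact hmax u hu
      · rw [weight_eq_zero hx hu]
        exact x.nonneg w

end Realization

namespace Subdivision

variable {V V' : Type u} {K' : AbstractSimplicialComplex V'} {K : AbstractSimplicialComplex V}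
  (S : Subdivision K' K)

open Classical in
/-- A vertex of `K'` of maximal weight at the given point of `|K|`; a junk value outside `|K|`. -/
noncomputable def nearVertex [Nonempty V'] (y : V →₀ ℝ) : V' :=
  if h : ∃ x, (S.homeo x).weight = y then h.choose.maxVertex else Classical.arbitrary V'

theorem nearVertex_weight [Nonempty V'] (x : Realization K') :
    S.nearVertex (S.homeo x).weight = x.maxVertex := by
  have h : ∃ z, (S.homeo z).weight = (S.homeo x).weight := ⟨x, rfl⟩
  have : h.choose = x := S.homeo.injective (Realization.ext h.choose_spec)
  rw [nearVertex, dif_pos h, this]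

/-- The convex sets of points for which `nearVertex` takes its values in a simplex of `K'`. -/
def smallSets [Nonempty V'] : Set (Set (V →₀ ℝ)) :=
  {U | Convex ℝ U ∧ ∃ s ∈ K'.faces, ∀ y ∈ U, S.nearVertex y ∈ s}

/-- Every closed simplex of `K` is compact and covered by the open sets `maxIn K' s`. By Lebesgue's
number lemma, all points of a sufficiently small subset of it have maximal weight at vertices of a
single simplex of `K'` only. -/
theorem isFineIn_smallSets [Nonempty V'] :
    IsFineIn S.smallSets {U | ∃ s ∈ K.faces, U = cell s} where
  convex_left U hU := hU.1
  convex_right := by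
    rintro _ ⟨s, -, rfl⟩
    exact convex_cell s
  exists_ball := by
    rintro _ ⟨s, hs, rfl⟩
    let f : stdSimplex ℝ s → Realization K' := fun a => S.homeo.symm (ofStdSimplex hs a)
    have hf : Continuous f := S.homeo.symm.continuous.comp (continuous_ofStdSimplex hs)
    obtain ⟨δ, hδ, hball⟩ := lebesgue_number_lemma_of_metric
      (isCompact_univ (X := stdSimplex ℝ s))
      (c := fun t : {t : Finset V' // t ∈ K'.faces} => f ⁻¹' maxIn K' t.1)
      (fun t => (isOpen_maxIn t.1).preimage hf) (by
        intro a _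
        refine Set.mem_iUnion.2 ⟨⟨_, (f a).support_mem⟩, fun w hw => ?_⟩
        have h₁ := hw (f a).maxVertex
        have h₂ := Finsupp.mem_support_iff.1 (maxVertex_mem (f a))
        exact Finsupp.mem_support_iff.2 fun h₀ =>
          h₂ (le_antisymm (h₁.trans h₀.le) ((f a).nonneg _)))
    let ℓ : (V →₀ ℝ) →ₗ[ℝ] (s → ℝ) := LinearMap.pi fun v => Finsupp.lapply v.1
    refine ⟨(normSeminorm ℝ (s → ℝ)).comp ℓ, δ, hδ, fun x hx => ⟨(convex_cell s).inter
      (Seminorm.convex_ball _ _ _), ?_⟩⟩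
    have hpoint : ∀ y ∈ cell s, ∃ a : stdSimplex ℝ s, (a.1 : s → ℝ) = ℓ y ∧
        (S.homeo (f a)).weight = y := by
      intro y hy
      obtain ⟨z, rfl, hz⟩ := exists_weight_eq hs hy
      refine ⟨toStdSimplex s ⟨z, hz⟩, rfl, ?_⟩
      simp only [f, S.homeo.apply_symm_apply, ofStdSimplex_toStdSimplex]
    obtain ⟨a, ha, -⟩ := hpoint x hx
    obtain ⟨t, ht⟩ := hball a trivial
    refine ⟨t.1, t.2, fun y hy => ?_⟩
    obtain ⟨b, hb, hby⟩ := hpoint y hy.1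
    have hdist : b ∈ Metric.ball a δ := by
      have := hy.2
      rw [Seminorm.mem_ball, Seminorm.comp_apply, coe_normSeminorm, map_sub, ← ha, ← hb,
        ← dist_eq_norm] at this
      exact this
    rw [← hby, S.nearVertex_weight]
    exact ht hdist _ (weight_le_maxVertex _)

/-- The vertices of a simplex of `K'` lie in a set of points where `nearVertex` takes its values
in this simplex. -/
theorem exists_smallSet [Nonempty V'] {s : Finset V'} (hs : s ∈ K'.faces) :
    ∃ U ∈ S.smallSets, ∀ v ∈ s, (S.homeo (vertex K' v)).weight ∈ U := by
  refine ⟨S.push '' cell s, ⟨(convex_cell s).linear_image _, s, hs, ?_⟩, fun v hv => ?_⟩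
  · rintro _ ⟨y, hy, rfl⟩
    obtain ⟨x, rfl, hx⟩ := exists_weight_eq hs hy
    rw [← homeo_weight, nearVertex_weight]
    exact hx (maxVertex_mem x)
  · refine ⟨_, weight_mem_cell (x := vertex K' v) ?_, (S.homeo_weight _).symm⟩
    simpa [vertex, Finsupp.support_single] using hv

end Subdivision

end AbstractSimplicialComplex

namespace FormalMap

open CrossedModule AffineChain

variable {C : Type v} {P : Type w} [Group C] [Group P] [MulDistribMulAction P C]
  {𝒞 : CrossedModule C P} {V V' : Type u} {K' : AbstractSimplicialComplex V'}
  {K : AbstractSimplicialComplex V}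

theorem HasLabels.congr {φ : FormalMap 𝒞 K} {p p' : V → V → P} {c c' : V → V → V → C}
    (h : φ.HasLabels p c)
    (hp : ∀ s ∈ K.faces, ∀ x ∈ s, ∀ y ∈ s, p' x y = p x y)
    (hc : ∀ s ∈ K.faces, ∀ x ∈ s, ∀ y ∈ s, ∀ z ∈ s, c' x y z = c x y z) :
    φ.HasLabels p' c' where
  p_eq x y hxy e he := by
    have hmem : ∀ a ∈ ({x, y} : Set V), a ∈ (e.1 : Set V) := fun a ha => he ▸ ha
    rw [h.p_eq x y hxy e he, hp e.1 e.2.1 x (hmem x (by simp)) y (hmem y (by simp))]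
  c_eq x y z hxy hyz t ht := by
    have hmem : ∀ a ∈ ({x, y, z} : Set V), a ∈ (t.1 : Set V) := fun a ha => ht ▸ ha
    rw [h.c_eq x y z hxy hyz t ht, hc t.1 t.2.1 x (hmem x (by simp)) y (hmem y (by simp)) z
      (hmem z (by simp))]

/-- A formal map on `K` extends to the tuples of points that lie in a common simplex of `K`, by
means of a map that sends each point to a vertex of its carrier. -/
theorem exists_isCocycleOn_cell (φ : FormalMap 𝒞 K) :
    ∃ (p : (V →₀ ℝ) → (V →₀ ℝ) → P) (c : (V →₀ ℝ) → (V →₀ ℝ) → (V →₀ ℝ) → C),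
      𝒞.IsCocycleOn {U | ∃ s ∈ K.faces, U = cell s} p c ∧
      φ.HasLabels (fun x y => p (vertex K x).weight (vertex K y).weight)
        fun x y z => c (vertex K x).weight (vertex K y).weight (vertex K z).weight := by
  classical
  obtain ⟨p, c, hpc, hφ⟩ := φ.exists_isCocycleOn
  rcases isEmpty_or_nonempty V with hV | hV
  · exact ⟨_, _, 𝒞.isCocycleOn_one _, ⟨fun x => hV.elim x, fun x => hV.elim x⟩⟩
  have hr : ∀ y : V →₀ ℝ, ∃ v, y ≠ 0 → v ∈ y.support := by
    intro y
    by_cases hy : y = 0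
    · exact ⟨Classical.arbitrary V, fun h => absurd hy h⟩
    · obtain ⟨v, hv⟩ := Finset.nonempty_iff_ne_empty.2 (mt Finsupp.support_eq_empty.1 hy)
      exact ⟨v, fun _ => hv⟩
  choose r hr using hr
  have hrv : ∀ v, r (vertex K v).weight = v := by
    intro v
    have := hr (vertex K v).weight (by simp [vertex])
    simpa [vertex, Finsupp.support_single] using this
  refine ⟨_, _, hpc.comp r ?_, ?_⟩
  · rintro _ ⟨s, hs, rfl⟩
    refine ⟨_, ⟨s, hs, rfl⟩, fun y hy => hy.2.2 (hr y ?_)⟩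
    rintro rfl
    simpa using hy.2.1
  · simpa only [hrv] using hφ

/-- A formal map on a subdivision of `K` extends to the tuples of points that lie in a common
simplex of `K`. -/
theorem exists_isCocycleOn_cell_of_subdivision (S : Subdivision K' K) (φ : FormalMap 𝒞 K') :
    ∃ (p : (V →₀ ℝ) → (V →₀ ℝ) → P) (c : (V →₀ ℝ) → (V →₀ ℝ) → (V →₀ ℝ) → C),
      𝒞.IsCocycleOn {U | ∃ s ∈ K.faces, U = cell s} p c ∧
      φ.HasLabels (fun x y => p (S.homeo (vertex K' x)).weight (S.homeo (vertex K' y)).weight)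
        fun x y z => c (S.homeo (vertex K' x)).weight (S.homeo (vertex K' y)).weight
          (S.homeo (vertex K' z)).weight := by
  obtain ⟨p, c, hpc, hφ⟩ := φ.exists_isCocycleOn
  rcases isEmpty_or_nonempty V' with hV | hV
  · exact ⟨_, _, 𝒞.isCocycleOn_one _, ⟨fun x => hV.elim x, fun x => hV.elim x⟩⟩
  have hsmall : 𝒞.IsCocycleOn S.smallSets (fun x y => p (S.nearVertex x) (S.nearVertex y))
      (fun x y z => c (S.nearVertex x) (S.nearVertex y) (S.nearVertex z)) := by
    refine hpc.comp S.nearVertex ?_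
    rintro U ⟨-, s, hs, hU⟩
    exact ⟨_, ⟨s, hs, rfl⟩, hU⟩
  obtain ⟨p', c', hpc', hp', hc'⟩ := hsmall.exists_extension S.isFineIn_smallSets
  have hnear : ∀ v, S.nearVertex (S.homeo (vertex K' v)).weight = v := fun v => by
    rw [S.nearVertex_weight, maxVertex_vertex]
  refine ⟨p', c', hpc', hφ.congr ?_ ?_⟩
  · intro s hs x hx y hy
    obtain ⟨U, hU, hsU⟩ := S.exists_smallSet hs
    rw [hp' U hU _ (hsU x hx) _ (hsU y hy), hnear, hnear]
  · intro s hs x hx y hy z hz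
    obtain ⟨U, hU, hsU⟩ := S.exists_smallSet hs
    rw [hc' U hU _ (hsU x hx) _ (hsU y hy) _ (hsU z hz), hnear, hnear, hnear]

/-- A cocycle on points of a complex, evaluated at the vertices of a subdivision, gives a formal
map for any total order of the vertices. -/
theorem exists_hasLabels_of_isCocycleOn_cell (S : Subdivision K' K)
    {p : (V →₀ ℝ) → (V →₀ ℝ) → P} {c : (V →₀ ℝ) → (V →₀ ℝ) → (V →₀ ℝ) → C}
    (h : 𝒞.IsCocycleOn {U | ∃ s ∈ K.faces, U = cell s} p c) :
    ∃ φ : FormalMap 𝒞 K',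
      φ.HasLabels (fun x y => p (S.homeo (vertex K' x)).weight (S.homeo (vertex K' y)).weight)
        fun x y z => c (S.homeo (vertex K' x)).weight (S.homeo (vertex K' y)).weight
          (S.homeo (vertex K' z)).weight := by
  let o : LinearOrder V' := IsWellOrder.linearOrder WellOrderingRel
  obtain ⟨φ, -, hφ⟩ := exists_of_isCocycleOn (K := K') o.toPartialOrder
    (fun s _ x _ y _ => o.le_total x y) (h.comp (fun v => (S.homeo (vertex K' v)).weight) (by
      rintro _ ⟨s, hs, rfl⟩
      obtain ⟨t, ht, hst⟩ := S.exists_carrier_subset hs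
      exact ⟨_, ⟨t, ht, rfl⟩, fun v hv => weight_mem_cell (hst v hv)⟩))
  exact ⟨φ, hφ⟩

end FormalMap

/-- The trivial subdivision. -/
def AbstractSimplicialComplex.Subdivision.refl {V : Type u} (K : AbstractSimplicialComplex V) :
    AbstractSimplicialComplex.Subdivision K K where
  homeo := Homeomorph.refl _
  exists_face s hs := ⟨s, hs, fun _ hx => hx⟩
  affine x w := by
    classical
    simp only [Homeomorph.refl_apply, id, vertex, Finsupp.single_apply, mul_ite, mul_one, mul_zero]
    rw [Finsupp.sum_ite_eq']
    split_ifs with h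
    · rfl
    · exact Finsupp.notMem_support_iff.1 h

theorem mainTheorem9 {C : Type v} {P : Type w} [Group C] [Group P] [MulDistribMulAction P C]
    (𝒞 : CrossedModule C P) {V V' : Type u}
    (K : AbstractSimplicialComplex V) (K' : AbstractSimplicialComplex V')
    (S : AbstractSimplicialComplex.Subdivision K' K) (B : Set V) :
    (∀ φ : FormalMap 𝒞 K, ∃ φ' : FormalMap 𝒞 K',
      FormalMap.Equivalent (AbstractSimplicialComplex.Realization.vertex K '' B)
        (Homeomorph.refl _) S.homeo φ φ') ∧
    (∀ φ' : FormalMap 𝒞 K', ∃ φ : FormalMap 𝒞 K,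
      FormalMap.Equivalent (AbstractSimplicialComplex.Realization.vertex K '' B)
        (Homeomorph.refl _) S.homeo φ φ') := by
  refine ⟨fun φ => ?_, fun φ' => ?_⟩
  · obtain ⟨p, c, h, hφ⟩ := φ.exists_isCocycleOn_cell
    obtain ⟨φ', hφ'⟩ := FormalMap.exists_hasLabels_of_isCocycleOn_cell S h
    exact ⟨φ', FormalMap.equivalent_of_isCocycleOn S B h hφ hφ'⟩
  · obtain ⟨p, c, h, hφ'⟩ := φ'.exists_isCocycleOn_cell_of_subdivision S
    obtain ⟨φ, hφ⟩ := FormalMap.exists_hasLabels_of_isCocycleOn_cell (Subdivision.refl K) h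
    exact ⟨φ, FormalMap.equivalent_of_isCocycleOn S B h hφ hφ'⟩
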